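/- Let $[n]=\{1,\dots,n\}$. Let $B_n$ be the group of signed permutations, i.e. bijections $w$ of $[-n,n]\setminus\{0\}$ with $w(-i)=-w(i)$, under composition; put $\mathrm{Neg}(w)=\{i\in[n]: w(i)<0\}$ and $\mathrm{neg}(w)=\#\mathrm{Neg}(w)$, and let $D_n=\{w\in B_n : \mathrm{neg}(w)\text{ is even}\}$. Consider $D_n$ as a Coxeter group with generators $S_D=\{s_0^D,s_1,\dots,s_{n-1}\}$ (none if $n\le 1$), where in cycle notation $s_0^D=(1,-2)(-1,2)$ and $s_i=(i,i+1)(-i,-i-1)$. Let $D_n$ act on $\mathbb R^n$ by $w e_i=e_{w(i)}$, where $e_{-i}=-e_i$. The simple roots are $\alpha_{s_0^D}=e_1+e_2$ and $\alpha_{s_i}=e_{i+1}-e_i$; the root system $\Phi$ consists of the vectors $u(\alpha_s)$, $u\in D_n$, $s\in S_D$; $\Phi^+$ is the set of roots that are nonnegative combinations of simple roots, and $\Phi^-=-\Phi^+$. For $\beta=u(\alpha_s)$ let $t_\beta=usu^{-1}$. The depth of $\beta\in\Phi^+$ is $$\mathrm{dp}(\beta)=\min\{r : s_1\cdots s_r(\beta)\in\Phi^-\text{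 for some } s_1,\dots,s_r\in S_D\},$$ and the depth of $w\in D_n$ is $$\mathrm{dp}(w)=\min\Big\{\sum_{i=1}^r\mathrm{dp}(\beta_i) : w=t_{\beta_1}\cdots t_{\beta_r},\ \beta_i\in\Phi^+\Big\}.$$ For $u\in B_k$ and $v\in B_l$, the direct sum $u\oplus v\in B_{k+l}$ is given by $(u\oplus v)(i)=u(i)$ for $1\le i\le k$ and $(u\oplus v)(i)=\mathrm{sign}(v(i-k))\,(|v(i-k)|+k)$ for $k+1\le i\le k+l$; it is nontrivial if $k,l\ge1$. The type B blocks of $w$ are the summands of its unique expression as a direct sum of signed permutations of positive size, none of which is a nontrivial direct sum. For $w\in D_n$, the type D blocks of $w$ are the summands of its unique expression as a direct sum of elements of groups $D_m$ with $m\ge1$, none of which is a nontrivial direct sum of two such elements. The D-oddness $o^D(w)$ is the number of type B blocks of $w$ minus the number of type D blocks of $w$. **Theorem.** For every $n$ and every $w\in D_n$, $$\mathrm{dp}(w)=\sum_{i\in[n],\,w(i)>i}(w(i)-i)+\sum_{i\in\mathrm{Neg}(w)}|w(i)|+\big(o^D(w)-\mathrm{neg}(w)\big),$$ and equivalently $$\mathrm{dp}(w)=\frac12\Big(\sum_{i\in[-n,n]\setminus\{0\},\,w(i)>i}(w(i)-i)-2\,\mathrm{neg}(w)\Big)+o^D(w).$$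 -/

import Mathlib

namespace SignedPerm

/-! ### The groups `B_n` and `D_n` -/

/-- The set `[-n, n] \ {0}`. -/
noncomputable abbrev punctured (n : ℕ) : Finset ℤ := (Finset.Icc (-(n : ℤ)) n).erase 0

/-- The value `w(i)` of a permutation `w` of `[-n, n] \ {0}` at an integer `i`
(extended by `w(i) = i` to the integers outside this set). -/
noncomputable def val {n : ℕ} (w : Equiv.Perm (punctured n)) (i : ℤ) : ℤ := Equiv.Perm.ofSubtype w i

theorem mem_punctured {n : ℕ} {i : ℤ} : i ∈ punctured n ↔ i ≠ 0 ∧ -(n : ℤ) ≤ i ∧ i ≤ n := by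
  simp [punctured]

theorem val_mem {n : ℕ} (w : Equiv.Perm (punctured n)) {i : ℤ} (hi : i ∈ punctured n) :
    val w i ∈ punctured n := by
  unfold val
  rw [Equiv.Perm.ofSubtype_apply_of_mem w hi]
  exact (w ⟨i, hi⟩).2

theorem val_one {n : ℕ} (i : ℤ) : val (1 : Equiv.Perm (punctured n)) i = i := by
  simp [val]

theorem val_mul {n : ℕ} (u v : Equiv.Perm (punctured n)) (i : ℤ) :
    val (u * v) i = val u (val v i) := by
  simp [val]

theorem val_injective {n : ℕ} (w : Equiv.Perm (punctured n)) : Function.Injective (val w) :=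
  (Equiv.Perm.ofSubtype w).injective

theorem val_coe {n : ℕ} (w : Equiv.Perm (punctured n)) (i : punctured n) :
    val w i = w i := Equiv.Perm.ofSubtype_apply_coe w i

/-- The group `B_n` of signed permutations: the bijections `w` of `[-n, n] \ {0}` onto itself with
`w(-i) = -w(i)`, under composition. -/
def groupB (n : ℕ) : Subgroup (Equiv.Perm (punctured n)) where
  carrier := {w | ∀ i ∈ punctured n, val w (-i) = -val w i}
  one_mem' := by intro i _; simp [val_one]
  mul_mem' := by
    intro u v hu hv i hi
    rw [val_mul, val_mul, hv i hi, hu _ (val_mem v hi)]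
  inv_mem' := by
    intro w hw i hi
    apply val_injective w
    rw [hw _ (val_mem _ hi), ← val_mul, ← val_mul, mul_inv_cancel, val_one, val_one]

/-- `neg(w)`, the number of elements of `Neg(w) = {i ∈ [n] | w(i) < 0}`. -/
noncomputable def neg {n : ℕ} (w : Equiv.Perm (punctured n)) : ℕ :=
  ((Finset.Icc (1 : ℤ) n).filter (fun i => val w i < 0)).card

theorem prod_sign {n : ℕ} (w : Equiv.Perm (punctured n)) :
    ∏ i ∈ Finset.Icc (1 : ℤ) n, (val w i).sign = (-1) ^ neg w := by
  have h : ∀ i ∈ Finset.Icc (1 : ℤ) n, (val w i).sign = if val w i < 0 then -1 else 1 := by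
    intro i hi
    rw [Finset.mem_Icc] at hi
    have h0 := (mem_punctured.1 (val_mem w (mem_punctured.2
      ⟨by omega, by omega, by omega⟩ : i ∈ punctured n))).1
    split_ifs with h
    · exact Int.sign_eq_neg_one_of_neg h
    · exact Int.sign_eq_one_of_pos (by omega)
  rw [Finset.prod_congr rfl h, Finset.prod_ite]
  simp [neg]

theorem even_neg_iff {n : ℕ} (w : Equiv.Perm (punctured n)) :
    Even (neg w) ↔ ∏ i ∈ Finset.Icc (1 : ℤ) n, (val w i).sign = 1 := by
  rw [prod_sign, neg_one_pow_eq_one_iff_even (by decide)]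

theorem prod_sign_mul {n : ℕ} {u v : Equiv.Perm (punctured n)} (hu : u ∈ groupB n)
    (hv : v ∈ groupB n) :
    ∏ i ∈ Finset.Icc (1 : ℤ) n, (val (u * v) i).sign =
      (∏ i ∈ Finset.Icc (1 : ℤ) n, (val u i).sign) *
        ∏ i ∈ Finset.Icc (1 : ℤ) n, (val v i).sign := by
  have hI : ∀ i ∈ Finset.Icc (1 : ℤ) n, i ∈ punctured n := by
    intro i hi
    rw [Finset.mem_Icc] at hi
    exact mem_punctured.2 ⟨by omega, by omega, by omega⟩
  have h1 : ∀ i ∈ Finset.Icc (1 : ℤ) n,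
      (val (u * v) i).sign = (val u |val v i|).sign * (val v i).sign := by
    intro i hi
    have hm := val_mem v (hI i hi)
    rw [val_mul]
    rcases lt_or_gt_of_ne (mem_punctured.1 hm).1 with h | h
    · rw [abs_of_neg h, hu _ hm, Int.sign_neg, Int.sign_eq_neg_one_of_neg h]; ring
    · rw [abs_of_pos h, Int.sign_eq_one_of_pos h, mul_one]
  rw [Finset.prod_congr rfl h1, Finset.prod_mul_distrib]
  congr 1
  have hmaps : ∀ i ∈ Finset.Icc (1 : ℤ) n, |val v i| ∈ Finset.Icc (1 : ℤ) n := by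
    intro i hi
    have hm := mem_punctured.1 (val_mem v (hI i hi))
    rw [Finset.mem_Icc]
    rcases abs_cases (val v i) with h | h <;> constructor <;> omega
  have hinj : Set.InjOn (fun i => |val v i|) (Finset.Icc (1 : ℤ) n : Set ℤ) := by
    intro i hi j hj hij
    rw [Finset.mem_coe] at hi hj
    rcases abs_eq_abs.1 hij with h | h
    · exact val_injective v h
    · rw [← hv j (hI j hj)] at h
      have := val_injective v h
      rw [Finset.mem_Icc] at hi hj
      omega
  have hsurj := Finset.surjOn_of_injOn_of_card_le (fun i => |val v i|) hmaps hinj le_rfl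
  exact Finset.prod_nbij (fun i => |val v i|) hmaps hinj hsurj (fun _ _ => rfl)

/-- The group `D_n` of even signed permutations: the `w ∈ B_n` with `neg(w)` even. -/
def groupD (n : ℕ) : Subgroup (Equiv.Perm (punctured n)) where
  carrier := {w | w ∈ groupB n ∧ Even (neg w)}
  one_mem' := by
    refine ⟨one_mem _, (even_neg_iff _).2 (Finset.prod_eq_one fun i hi => ?_)⟩
    rw [Finset.mem_Icc] at hi
    rw [val_one, Int.sign_eq_one_of_pos (by omega)]
  mul_mem' := by
    rintro u v ⟨hu, hu'⟩ ⟨hv, hv'⟩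
    refine ⟨mul_mem hu hv, ?_⟩
    rw [even_neg_iff] at *
    rw [prod_sign_mul hu hv, hu', hv', mul_one]
  inv_mem' := by
    rintro w ⟨hw, hw'⟩
    refine ⟨inv_mem hw, ?_⟩
    rw [even_neg_iff] at *
    have h := prod_sign_mul hw (inv_mem hw)
    rw [hw', one_mul] at h
    rw [← h, mul_inv_cancel]
    refine Finset.prod_eq_one fun i hi => ?_
    rw [Finset.mem_Icc] at hi
    rw [val_one, Int.sign_eq_one_of_pos (by omega)]

/-! ### The Coxeter generators of `D_n` and its root system -/

/-- The negative `-a` in `[-n, n] \ {0}`. -/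
def opp {n : ℕ} (a : punctured n) : punctured n :=
  ⟨-a.1, mem_punctured.2 (by have := mem_punctured.1 a.2; omega)⟩

/-- Index set of the Coxeter generators of `D_n`: the pair `(-1, 2)` stands for `s_0^D`, and the
pair `(i, i + 1)`, `1 ≤ i < n`, stands for `s_i`. For `n ≤ 1` there are no generators. -/
abbrev SimpleIdx (n : ℕ) : Type :=
  {p : punctured n × punctured n //
    ((p.1 : ℤ) = -1 ∧ (p.2 : ℤ) = 2) ∨ (1 ≤ (p.1 : ℤ) ∧ (p.2 : ℤ) = p.1 + 1)}

/-- The Coxeter generator with index `(a, b)` as a permutation, in cycle notation `(a, b)(-a, -b)`.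
Thus `s_0^D = (-1, 2)(1, -2)` and `s_i = (i, i + 1)(-i, -i - 1)`. -/
def simplePerm {n : ℕ} (p : SimpleIdx n) : Equiv.Perm (punctured n) :=
  Equiv.swap p.1.1 p.1.2 * Equiv.swap (opp p.1.1) (opp p.1.2)

theorem simplePerm_apply {n : ℕ} (p : SimpleIdx n) (i : punctured n) :
    (simplePerm p i : ℤ) =
      if (i : ℤ) = p.1.1 then (p.1.2 : ℤ) else if (i : ℤ) = p.1.2 then (p.1.1 : ℤ)
      else if (i : ℤ) = -p.1.1 then -(p.1.2 : ℤ) else if (i : ℤ) = -p.1.2 then -(p.1.1 : ℤ)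
      else i := by
  obtain ⟨⟨a, b⟩, hp⟩ := p
  simp only [simplePerm, Equiv.Perm.mul_apply, Equiv.swap_apply_def, opp]
  simp only at hp
  grind

theorem simplePerm_mem {n : ℕ} (p : SimpleIdx n) : simplePerm p ∈ groupD n := by
  obtain ⟨⟨a, b⟩, hp⟩ := p
  simp only at hp
  have ha := mem_punctured.1 a.2
  have hb := mem_punctured.1 b.2
  refine ⟨fun i hi => ?_, ?_⟩
  · have h1 := val_coe (simplePerm ⟨(a, b), hp⟩) ⟨i, hi⟩
    have h2 := val_coe (simplePerm ⟨(a, b), hp⟩) (opp ⟨i, hi⟩)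
    rw [simplePerm_apply] at h1 h2
    simp only [opp] at h1 h2
    rw [h1, h2]
    have := mem_punctured.1 hi
    grind
  · have hv : ∀ i ∈ Finset.Icc (1 : ℤ) n, val (simplePerm ⟨(a, b), hp⟩) i =
        if i = (a : ℤ) then (b : ℤ) else if i = (b : ℤ) then (a : ℤ)
        else if i = -(a : ℤ) then -(b : ℤ) else if i = -(b : ℤ) then -(a : ℤ) else i := by
      intro i hi
      rw [Finset.mem_Icc] at hi
      have h1 := val_coe (simplePerm ⟨(a, b), hp⟩)
        ⟨i, mem_punctured.2 ⟨by omega, by omega, by omega⟩⟩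
      rw [simplePerm_apply] at h1
      exact h1
    unfold neg
    rw [Finset.filter_congr (fun i hi => by rw [hv i hi])]
    rcases hp with ⟨h1, h2⟩ | ⟨h1, h2⟩
    · have : (Finset.Icc (1 : ℤ) n).filter (fun i : ℤ =>
          (if i = (a : ℤ) then (b : ℤ) else if i = (b : ℤ) then (a : ℤ)
            else if i = -(a : ℤ) then -(b : ℤ) else if i = -(b : ℤ) then -(a : ℤ) else i) < 0) =
          ({1, 2} : Finset ℤ) := by
        ext i
        simp only [Finset.mem_filter, Finset.mem_Icc, Finset.mem_insert, Finset.mem_singleton]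
        grind
      rw [this]
      decide
    · have : (Finset.Icc (1 : ℤ) n).filter (fun i : ℤ =>
          (if i = (a : ℤ) then (b : ℤ) else if i = (b : ℤ) then (a : ℤ)
            else if i = -(a : ℤ) then -(b : ℤ) else if i = -(b : ℤ) then -(a : ℤ) else i) < 0) = ∅ := by
        ext i
        simp only [Finset.mem_filter, Finset.mem_Icc, Finset.notMem_empty, iff_false]
        grind
      rw [this]
      decide

/-- The Coxeter generators `S_D = {s_0^D, s_1, …, s_{n-1}}` as elements of `D_n`. -/
def simple {n : ℕ} (p : SimpleIdx n) : groupD n := ⟨simplePerm p, simplePerm_mem p⟩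

/-- The vector `e_a` of `ℝ^n` for an integer `a` with `1 ≤ |a| ≤ n`: the standard basis vector if
`a > 0`, and `e_{-a} = -e_a`. The coordinate `k : Fin n` is the `(k + 1)`-st one. -/
def basisVec (n : ℕ) (a : ℤ) : Fin n → ℝ :=
  fun k => if a = (k : ℤ) + 1 then 1 else if a = -((k : ℤ) + 1) then -1 else 0

/-- The linear action of `D_n` on `ℝ^n` with `w e_i = e_{w(i)}` for `i ∈ [n]`. -/
noncomputable def act {n : ℕ} (w : groupD n) (x : Fin n → ℝ) : Fin n → ℝ :=
  ∑ k : Fin n, x k • basisVec n (val w.1 ((k : ℤ) + 1))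

/-- The simple root of the generator `(a, b)(-a, -b)`, namely `e_b - e_a`. Thus the simple roots
are `e_1 + e_2` for `s_0^D` and `e_{i+1} - e_i` for `s_i`. -/
def simpleRoot {n : ℕ} (p : SimpleIdx n) : Fin n → ℝ :=
  basisVec n p.1.2 - basisVec n p.1.1

/-- The root system `Φ`: the orbit of the simple roots. -/
def roots (n : ℕ) : Set (Fin n → ℝ) :=
  {β | ∃ (u : groupD n) (p : SimpleIdx n), β = act u (simpleRoot p)}

/-- The positive roots `Φ⁺`: the roots that are nonnegative combinations of simple roots. -/
def posRoots (n : ℕ) : Set (Fin n → ℝ) :=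
  {β | β ∈ roots n ∧
    ∃ c : SimpleIdx n → ℝ, (∀ p, 0 ≤ c p) ∧ β = ∑ p : SimpleIdx n, c p • simpleRoot p}

/-- The negative roots `Φ⁻ = -Φ⁺`. -/
def negRoots (n : ℕ) : Set (Fin n → ℝ) := {β | -β ∈ posRoots n}

/-- `t` is the reflection `t_β` of the root `β`: `β = u(α_s)` and `t = u s u⁻¹` for some `u ∈ D_n`
and some Coxeter generator `s` with simple root `α_s`. -/
def IsReflectionOf {n : ℕ} (t : groupD n) (β : Fin n → ℝ) : Prop :=
  ∃ (u : groupD n) (p : SimpleIdx n), β = act u (simpleRoot p) ∧ t = u * simple p * u⁻¹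

/-! ### Depth -/

/-- The depth of a (positive) root: the least `r` such that `s_1 ⋯ s_r (β) ∈ Φ⁻` for some
Coxeter generators `s_1, …, s_r`. -/
noncomputable def rootDepth {n : ℕ} (β : Fin n → ℝ) : ℕ :=
  sInf {r | ∃ l : List (SimpleIdx n), l.length = r ∧ act (l.map simple).prod β ∈ negRoots n}

/-- The depth `dp(w)` of `w ∈ D_n` for the Coxeter system `(D_n, S_D)`: the minimum of
`dp(β_1) + ⋯ + dp(β_r)` over all factorizations `w = t_{β_1} ⋯ t_{β_r}` into reflections of
positive roots `β_i`. -/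
noncomputable def depth {n : ℕ} (w : groupD n) : ℕ :=
  sInf {d | ∃ l : List (groupD n × (Fin n → ℝ)),
    (∀ x ∈ l, x.2 ∈ posRoots n ∧ IsReflectionOf x.1 x.2) ∧
    w = (l.map Prod.fst).prod ∧ d = (l.map fun x => rootDepth x.2).sum}

/-! ### Direct sums, blocks and oddness -/

/-- `w = u ⊕ v`: the signed permutation `w` of `[k + l]` has `w(i) = u(i)` for `i ∈ [1, k]` and
`w(i) = sign(v(i - k)) (|v(i - k)| + k)` for `i ∈ [k + 1, k + l]`. -/
def IsDirectSum {k l n : ℕ} (u : groupB k) (v : groupB l) (w : groupB n) : Prop :=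
  n = k + l ∧ (∀ i ∈ Finset.Icc (1 : ℤ) k, val w.1 i = val u.1 i) ∧
    ∀ i ∈ Finset.Icc ((k : ℤ) + 1) (k + l),
      val w.1 i = (val v.1 (i - k)).sign * (|val v.1 (i - k)| + k)

/-- `w` is the direct sum `w¹ ⊕ ⋯ ⊕ wᵐ` of the signed permutations in a list. -/
inductive IsSumOf : List (Σ k : ℕ, groupB k) → ∀ {n : ℕ}, groupB n → Prop
  | nil (w : groupB 0) : IsSumOf [] w
  | cons {k l n : ℕ} (u : groupB k) (v : groupB l) (w : groupB n) (L : List (Σ k : ℕ, groupB k)) :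
      IsSumOf L v → IsDirectSum u v w → IsSumOf (⟨k, u⟩ :: L) w

/-- `w ∈ B_n` is a nontrivial direct sum of signed permutations. -/
def DecomposableB {n : ℕ} (w : groupB n) : Prop :=
  ∃ (k l : ℕ) (u : groupB k) (v : groupB l), 1 ≤ k ∧ 1 ≤ l ∧ IsDirectSum u v w

/-- `w ∈ B_n` is a nontrivial direct sum of even signed permutations. -/
def DecomposableD {n : ℕ} (w : groupB n) : Prop :=
  ∃ (k l : ℕ) (u : groupB k) (v : groupB l), 1 ≤ k ∧ 1 ≤ l ∧
    u.1 ∈ groupD k ∧ v.1 ∈ groupD l ∧ IsDirectSum u v w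

/-- `L` is the type B decomposition of `w`: nonempty, indecomposable summands. -/
def IsTypeBDecomposition {n : ℕ} (L : List (Σ k : ℕ, groupB k)) (w : groupB n) : Prop :=
  IsSumOf L w ∧ ∀ x ∈ L, 1 ≤ x.1 ∧ ¬ DecomposableB x.2

/-- `L` is the type D decomposition of `w`: nonempty even summands, none of which is a nontrivial
direct sum of even signed permutations. -/
def IsTypeDDecomposition {n : ℕ} (L : List (Σ k : ℕ, groupB k)) (w : groupB n) : Prop :=
  IsSumOf L w ∧ ∀ x ∈ L, 1 ≤ x.1 ∧ x.2.1 ∈ groupD x.1 ∧ ¬ DecomposableD x.2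

/-- The number of type B blocks of `w`. (The decomposition is unique.) -/
noncomputable def numBlocksB {n : ℕ} (w : groupB n) : ℕ :=
  sInf {m | ∃ L, IsTypeBDecomposition L w ∧ m = L.length}

/-- The number of type D blocks of an even `w`. (The decomposition is unique.) -/
noncomputable def numBlocksD {n : ℕ} (w : groupB n) : ℕ :=
  sInf {m | ∃ L, IsTypeDDecomposition L w ∧ m = L.length}

/-- `w ∈ D_n` regarded as an element of `B_n`. -/
def toB {n : ℕ} (w : groupD n) : groupB n := ⟨w.1, w.2.1⟩

/-- The D-oddness `o^D(w)`: the number of type B blocks minus the number of type D blocks. -/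
noncomputable def oddnessD {n : ℕ} (w : groupD n) : ℤ :=
  (numBlocksB (toB w) : ℤ) - numBlocksD (toB w)

end SignedPerm

/-! ### Windows of signed permutations, swaps, and the bound on the change of cost -/

namespace SignedPerm

/-! The linear functional with value 1 on every simple root sends e_a to `shift a`, so the root e_b
- e_a has height `shift b - shift a`. As type D is simply laced, the depth of a positive root equals
its height (`rootDepth_rootVec`). Every positive root is e_j - ε e_i with 1 ≤ i < j ≤ n and ε = ±1,
and right multiplication by its reflection exchanges the values at i and j and multiplies both by ε
(`SwapAt`). Depth is therefore the least price of sorting the window of w by such swaps, each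
costing `shift j - ε * shift i`.

Call p a cut if w preserves [-p, p] \ {0}. The cuts in [1, n] are the right ends of the type B
blocks, and those with an even number of negative values on [1, p] are the right ends of the type D
blocks. Hence o^D(w) counts the odd cuts (`oddnessD_eq`), and both formulas say that 2 dp(w) is
`cost`: the displacement after shifting, plus 2 for each odd cut.

Lower bound (`SwapAt.cost_lipschitz`): a swap changes the displacement by at most twice its price,
and whenever it creates odd cuts, the slack in the triangle inequality pays for them. Upper bound
(`exists_descent`): unless w is the identity, some swap lowers the cost by at least twice its price.
Induction on the cost then gives a factorization that attains the bound. -/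

/-- The integer `a` moved one step towards zero. -/
def shift (a : ℤ) : ℤ := if 0 < a then a - 1 else if a < 0 then a + 1 else 0

/-- `g` restricts to a signed permutation of `[-n, n] \ {0}`. -/
structure IsSigned (n : ℤ) (g : ℤ → ℤ) : Prop where
  inj : Function.Injective g
  odd : ∀ i, g (-i) = -g i
  le : ∀ i, 1 ≤ i → i ≤ n → |g i| ≤ n

/-- `g` preserves `[-p, p] \ {0}`. -/
def IsCut (g : ℤ → ℤ) (p : ℤ) : Prop := ∀ i, 1 ≤ i → i ≤ p → |g i| ≤ p

/-- The number of negative values of `g` on `[1, p]`. -/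
noncomputable def negs (g : ℤ → ℤ) (p : ℤ) : ℕ := ((Finset.Icc 1 p).filter (fun i => g i < 0)).card

open Classical in
/-- The cuts `p ∈ [1, n]` with an odd number of negative values on `[1, p]`. -/
noncomputable def oddCuts (n : ℤ) (g : ℤ → ℤ) : Finset ℤ :=
  (Finset.Icc 1 n).filter (fun p => IsCut g p ∧ Odd (negs g p))

/-- The total displacement of `g`, measured after moving everything one step towards zero. -/
noncomputable def disp (n : ℤ) (g : ℤ → ℤ) : ℤ := ∑ i ∈ Finset.Icc 1 n, |shift (g i) - shift i|

/-- Twice the expected depth of `g`. -/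
noncomputable def cost (n : ℤ) (g : ℤ → ℤ) : ℤ := disp n g + 2 * (oddCuts n g).card

/-- `g'` arises from `g` by exchanging the values at `i < j` and multiplying both by `ε`. -/
structure SwapAt (n : ℤ) (g g' : ℤ → ℤ) (i j ε : ℤ) : Prop where
  one_le : 1 ≤ i
  lt : i < j
  le : j ≤ n
  sgn : ε = 1 ∨ ε = -1
  left : g' i = ε * g j
  right : g' j = ε * g i
  other : ∀ k, 1 ≤ k → k ≤ n → k ≠ i → k ≠ j → g' k = g k

theorem mem_oddCuts {n : ℤ} {g : ℤ → ℤ} {p : ℤ} :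
    p ∈ oddCuts n g ↔ 1 ≤ p ∧ p ≤ n ∧ IsCut g p ∧ Odd (negs g p) := by
  simp [oddCuts, and_assoc]

namespace IsSigned

variable {n : ℤ} {g : ℤ → ℤ}

theorem ne_zero (hg : IsSigned n g) {i : ℤ} (hi : i ≠ 0) : g i ≠ 0 := by
  intro h
  have h0 : g 0 = 0 := by have := hg.odd 0; simp only [neg_zero] at this; omega
  exact hi (hg.inj (h.trans h0.symm))

theorem abs_inj (hg : IsSigned n g) {i j : ℤ} (hi : 1 ≤ i) (hj : 1 ≤ j) (h : |g i| = |g j|) :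
    i = j := by
  rcases abs_eq_abs.1 h with h | h
  · exact hg.inj h
  · rw [← hg.odd] at h
    have := hg.inj h
    omega

theorem one_le_abs (hg : IsSigned n g) {i : ℤ} (hi : 1 ≤ i) : 1 ≤ |g i| :=
  Int.one_le_abs (hg.ne_zero (by omega))

/-- At a cut, i ↦ |g i| is an injection of [1, p] into itself, hence onto. -/
theorem exists_abs_eq (hg : IsSigned n g) {p : ℤ} (hp : IsCut g p) {m : ℤ} (h1 : 1 ≤ m)
    (h2 : m ≤ p) : ∃ k, 1 ≤ k ∧ k ≤ p ∧ |g k| = m := by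
  have := Finset.surjOn_of_injOn_of_card_le (s := Finset.Icc 1 p) (t := Finset.Icc 1 p)
    (fun i => |g i|)
    (fun i hi => by
      have := Finset.mem_Icc.1 hi
      exact Finset.mem_Icc.2 ⟨hg.one_le_abs this.1, hp i this.1 this.2⟩)
    (fun i hi j hj h => by
      have hi := Finset.mem_Icc.1 hi
      have hj := Finset.mem_Icc.1 hj
      exact hg.abs_inj hi.1 hj.1 h) le_rfl
  obtain ⟨k, hk, hkm⟩ := this (Finset.mem_coe.2 (Finset.mem_Icc.2 ⟨h1, h2⟩))
  have hk := Finset.mem_Icc.1 (Finset.mem_coe.1 hk)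
  exact ⟨k, hk.1, hk.2, hkm⟩

theorem lt_abs_of_cut (hg : IsSigned n g) {p k : ℤ} (hp0 : 0 ≤ p) (hp : IsCut g p) (hk : p < k) :
    p < |g k| := by
  by_contra! h
  obtain ⟨m, h1, h2, h3⟩ := hg.exists_abs_eq hp (hg.one_le_abs (by omega : 1 ≤ k)) h
  have := hg.abs_inj h1 (by omega) h3
  omega

theorem isCut_self (hg : IsSigned n g) : IsCut g n := hg.le

end IsSigned

theorem negs_split (g : ℤ → ℤ) {p q : ℤ} (h0 : 0 ≤ p) (h : p ≤ q) :
    negs g q = negs g p + ((Finset.Ioc p q).filter (fun i => g i < 0)).card := by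
  unfold negs
  rw [← Finset.card_union_of_disjoint, ← Finset.filter_union]
  · congr 2
    ext i
    simp only [Finset.mem_Icc, Finset.mem_union, Finset.mem_Ioc]
    omega
  · rw [Finset.disjoint_left]
    intro i
    simp only [Finset.mem_filter, Finset.mem_Icc, Finset.mem_Ioc]
    omega

theorem negs_eq_of_pos {g : ℤ → ℤ} {p q : ℤ} (h0 : 0 ≤ p) (h : p ≤ q)
    (hpos : ∀ k, p < k → k ≤ q → 0 < g k) : negs g q = negs g p := by
  rw [negs_split g h0 h, Nat.add_eq_left, Finset.card_eq_zero, Finset.filter_eq_empty_iff]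
  intro k hk
  have := Finset.mem_Ioc.1 hk
  have := hpos k this.1 this.2
  omega

theorem negs_congr {g g' : ℤ → ℤ} {p : ℤ} (h : ∀ k, 1 ≤ k → k ≤ p → g' k = g k) :
    negs g' p = negs g p := by
  unfold negs
  congr 1
  refine Finset.filter_congr fun k hk => ?_
  have := Finset.mem_Icc.1 hk
  rw [h k this.1 this.2]

theorem negs_zero (g : ℤ → ℤ) : negs g 0 = 0 := by simp [negs]

theorem negs_eq_succ {g : ℤ → ℤ} {p q i : ℤ} (h0 : 0 ≤ p) (hi : p < i) (hiq : i ≤ q) (hneg : g i < 0)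
    (hpos : ∀ k, p < k → k ≤ q → k ≠ i → 0 < g k) : negs g q = negs g p + 1 := by
  rw [negs_split g h0 (by omega : p ≤ q)]
  congr 1
  rw [Finset.card_eq_one]
  refine ⟨i, ?_⟩
  ext k
  simp only [Finset.mem_filter, Finset.mem_Ioc, Finset.mem_singleton]
  constructor
  · rintro ⟨⟨h1, h2⟩, h3⟩
    by_contra hk
    have := hpos k h1 h2 hk
    omega
  · rintro rfl
    exact ⟨⟨hi, hiq⟩, hneg⟩

theorem sum_eq_of_two {s : Finset ℤ} {f f' : ℤ → ℤ} {i j : ℤ} (hi : i ∈ s) (hj : j ∈ s) (hij : i ≠ j)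
    (h : ∀ k ∈ s, k ≠ i → k ≠ j → f' k = f k) :
    ∑ k ∈ s, f' k = ∑ k ∈ s, f k + (f' i + f' j - f i - f j) := by
  have hj' : j ∈ s.erase i := Finset.mem_erase.2 ⟨hij.symm, hj⟩
  rw [← Finset.add_sum_erase s f' hi, ← Finset.add_sum_erase s f hi,
    ← Finset.add_sum_erase _ f' hj', ← Finset.add_sum_erase _ f hj',
    Finset.sum_congr rfl fun k hk => ?_]
  · ring
  · simp only [Finset.mem_erase] at hk
    exact h k hk.2.2 hk.2.1 hk.1

namespace SwapAt

variable {n : ℤ} {g g' : ℤ → ℤ} {i j ε : ℤ}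

theorem abs_left (h : SwapAt n g g' i j ε) : |g' i| = |g j| := by
  rw [h.left, abs_mul]; rcases h.sgn with h | h <;> simp [h]

theorem abs_right (h : SwapAt n g g' i j ε) : |g' j| = |g i| := by
  rw [h.right, abs_mul]; rcases h.sgn with h | h <;> simp [h]

theorem disp_eq (h : SwapAt n g g' i j ε) :
    disp n g' = disp n g + (|shift (ε * g j) - shift i| + |shift (ε * g i) - shift j|
      - |shift (g i) - shift i| - |shift (g j) - shift j|) := by
  have := h.one_le; have := h.lt; have := h.le
  unfold disp
  rw [sum_eq_of_two (i := i) (j := j) (f := fun i => |shift (g i) - shift i|)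
    (f' := fun i => |shift (g' i) - shift i|), h.left, h.right]
  · simp; omega
  · simp; omega
  · omega
  · intro k hk h1 h2
    have := Finset.mem_Icc.1 hk
    rw [h.other k this.1 this.2 h1 h2]

theorem negs_eq_of_lt (h : SwapAt n g g' i j ε) {p : ℤ} (hp : p < i) : negs g' p = negs g p := by
  have := h.lt; have := h.le
  exact negs_congr fun k h1 h2 => h.other k h1 (by omega) (by omega) (by omega)

/-- Past j both affected positions are counted: ε = 1 only permutes their signs and ε = -1 flips two
of them, so the parity survives. -/
theorem odd_negs_iff (h : SwapAt n g g' i j ε) (hg : IsSigned n g) {p : ℤ} (hp : j ≤ p)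
    (hpn : p ≤ n) : Odd (negs g' p) ↔ Odd (negs g p) := by
  have := h.one_le; have := h.lt; have := h.le
  have key : (negs g' p : ℤ) = negs g p + ((if g' i < 0 then 1 else 0) + (if g' j < 0 then 1 else 0)
      - (if g i < 0 then 1 else 0) - (if g j < 0 then 1 else 0)) := by
    have e : ∀ f : ℤ → ℤ, (negs f p : ℤ) = ∑ k ∈ Finset.Icc 1 p, if f k < 0 then 1 else 0 := by
      intro f; simp [negs]
    rw [e, e]
    refine sum_eq_of_two (f := fun k => if g k < 0 then (1 : ℤ) else 0)
      (f' := fun k => if g' k < 0 then (1 : ℤ) else 0) ?_ ?_ ?_ ?_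
    · simp; omega
    · simp; omega
    · omega
    · intro k hk h1 h2
      have := Finset.mem_Icc.1 hk
      rw [h.other k this.1 (by omega) h1 h2]
  have hi := hg.ne_zero (by omega : i ≠ 0)
  have hj := hg.ne_zero (by omega : j ≠ 0)
  rw [h.left, h.right] at key
  simp only [Nat.odd_iff]
  rcases h.sgn with h | h <;> subst h <;> split_ifs at key <;> omega

theorem isCut_of_isCut (h : SwapAt n g g' i j ε) {p : ℤ} (hpn : p ≤ n) (hp : p < i ∨ j ≤ p)
    (hc : IsCut g' p) : IsCut g p := by
  have := h.one_le; have := h.lt; have := h.le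
  intro k h1 h2
  by_cases hi : k = i
  · subst hi; rw [← h.abs_right]; exact hc _ (by omega) (by omega)
  by_cases hj : k = j
  · subst hj; rw [← h.abs_left]; exact hc _ (by omega) (by omega)
  rw [← h.other k h1 (by omega) hi hj]
  exact hc k h1 h2

theorem mem_oddCuts_of_mem (h : SwapAt n g g' i j ε) (hg : IsSigned n g) {p : ℤ}
    (hp : p < i ∨ j ≤ p) (hc : p ∈ oddCuts n g') : p ∈ oddCuts n g := by
  obtain ⟨h1, h2, h3, h4⟩ := mem_oddCuts.1 hc
  refine mem_oddCuts.2 ⟨h1, h2, h.isCut_of_isCut h2 hp h3, ?_⟩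
  rcases hp with hp | hp
  · rwa [← h.negs_eq_of_lt hp]
  · rwa [← h.odd_negs_iff hg hp h2]

/-- Here A = g i and B = g j, while p and q are the least and greatest odd cuts of g' in [i, j), and
m is their number. These cuts force |B| ≤ p and |A| > q, so the triangle inequality is loose by
enough to absorb the at most q - p + 1 odd cuts. -/
theorem cost_lipschitz_aux {i j A B p q m ε a b : ℤ} (hi : 1 ≤ i) (hip : i ≤ p) (hpq : p ≤ q)
    (hqj : q < j) (hA : q < |A|) (hB : |B| ≤ p) (hB0 : B ≠ 0) (hm : m ≤ q - p + 1)
    (hε : ε = 1 ∨ ε = -1) (ha : a = shift (ε * A)) (hb : b = shift (ε * B)) :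
    |b - shift i| + |a - shift j| - |shift A - shift i| - |shift B - shift j| + 2 * m
      ≤ 2 * (shift j - ε * shift i) := by
  have ei : shift i = i - 1 := by simp only [shift]; split_ifs <;> omega
  have ej : shift j = j - 1 := by simp only [shift]; split_ifs <;> omega
  have eb : b = ε * shift B := by
    rw [hb]; rcases hε with rfl | rfl <;> simp only [shift] <;> split_ifs <;> omega
  have ea : a = ε * shift A := by
    rw [ha]; rcases hε with rfl | rfl <;> simp only [shift] <;> split_ifs <;> omega
  have hA' : q ≤ |shift A| := by
    simp only [shift]; split_ifs <;> rw [abs] at * <;> omega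
  have hB' : |shift B| ≤ p - 1 := by
    simp only [shift]; split_ifs <;> rw [abs] at * <;> omega
  rw [ei, ej, ea, eb]
  generalize shift A = x at *
  generalize shift B = y at *
  clear ha hb hA hB ea eb ei ej
  simp only [abs] at *
  rcases hε with rfl | rfl <;> omega

/-- An odd cut outside [i, j) was one before the swap, so only those in [i, j) can be new. -/
theorem cost_le_aux (h : SwapAt n g g' i j ε) (hg : IsSigned n g) :
    cost n g' ≤ cost n g + (|shift (ε * g j) - shift i| + |shift (ε * g i) - shift j|
      - |shift (g i) - shift i| - |shift (g j) - shift j|) +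
      2 * ((oddCuts n g').filter (fun p => i ≤ p ∧ p < j)).card := by
  have hsub : oddCuts n g' ⊆ oddCuts n g ∪ (oddCuts n g').filter (fun p => i ≤ p ∧ p < j) := by
    intro p hp
    by_cases hpi : i ≤ p ∧ p < j
    · exact Finset.mem_union_right _ (Finset.mem_filter.2 ⟨hp, hpi⟩)
    · exact Finset.mem_union_left _ (h.mem_oddCuts_of_mem hg (by omega) hp)
  have := (Finset.card_le_card hsub).trans (Finset.card_union_le _ _)
  unfold cost
  rw [h.disp_eq]
  omega

theorem cost_lipschitz (h : SwapAt n g g' i j ε) (hg : IsSigned n g) (hg' : IsSigned n g') :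
    cost n g' ≤ cost n g + 2 * (shift j - ε * shift i) := by
  have h1 := h.one_le; have h2 := h.lt; have h3 := h.le
  refine (h.cost_le_aux hg).trans ?_
  set S := (oddCuts n g').filter (fun p => i ≤ p ∧ p < j) with hS
  rcases S.eq_empty_or_nonempty with he | hne
  -- With no odd cut in [i, j), this is the triangle inequality, since |ε y - a| = |y - ε a| and |a
  -- - ε b| = |b - ε a|.
  · rw [he]
    have hi0 : 0 < i := by omega
    have hj0 : 0 < j := by omega
    have hij : shift i < shift j := by simp only [shift]; split_ifs <;> omega
    have hi' : 0 ≤ shift i := by simp only [shift]; split_ifs; omega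
    have eb : ∀ B, shift (ε * B) = ε * shift B := by
      intro B
      rcases h.sgn with h | h <;> rw [h] <;> simp only [shift] <;> split_ifs <;> omega
    rw [eb, eb, Finset.card_empty]
    generalize shift (g i) = x
    generalize shift (g j) = y
    generalize shift i = a at *
    generalize shift j = b at *
    simp only [abs]
    rcases h.sgn with h | h <;> rw [h] <;> omega
  · have hmin := Finset.mem_filter.1 (S.min'_mem hne)
    have hmax := Finset.mem_filter.1 (S.max'_mem hne)
    have hle := S.min'_le _ (S.max'_mem hne)
    have hcard : S.card ≤ (Finset.Icc (S.min' hne) (S.max' hne)).card :=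
      Finset.card_le_card fun p hp => Finset.mem_Icc.2 ⟨S.min'_le p hp, S.le_max' p hp⟩
    rw [Int.card_Icc] at hcard
    obtain ⟨-, -, c1, -⟩ := mem_oddCuts.1 hmin.1
    obtain ⟨-, -, c2, -⟩ := mem_oddCuts.1 hmax.1
    have hB : |g j| ≤ S.min' hne := by rw [← h.abs_left]; exact c1 i h1 hmin.2.1
    have hA : S.max' hne < |g i| := by
      rw [← h.abs_right]
      exact hg'.lt_abs_of_cut (by omega) c2 (by omega)
    have := cost_lipschitz_aux (m := S.card) h1 hmin.2.1 hle hmax.2.2 hA hB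
      (hg.ne_zero (by omega)) (by omega) h.sgn rfl rfl
    omega

end SwapAt
end SignedPerm

/-! ### Existence of a swap that lowers the cost by twice its price -/

namespace SignedPerm

variable {n : ℤ} {g g' : ℤ → ℤ}

theorem shift_of_pos {a : ℤ} (h : 0 < a) : shift a = a - 1 := by simp [shift, h]

theorem SwapAt.cost_le {i j ε : ℤ} (h : SwapAt n g g' i j ε) (hg : IsSigned n g)
    (hcut : ∀ p, i ≤ p → p < j → IsCut g' p → ¬ Odd (negs g' p)) :
    cost n g' ≤ cost n g + (|shift (ε * g j) - shift i| + |shift (ε * g i) - shift j|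
      - |shift (g i) - shift i| - |shift (g j) - shift j|) := by
  have h1 := h.cost_le_aux hg
  have : (oddCuts n g').filter (fun p => i ≤ p ∧ p < j) = ∅ := by
    rw [Finset.filter_eq_empty_iff]
    rintro p hp ⟨h2, h3⟩
    obtain ⟨-, -, h4, h5⟩ := mem_oddCuts.1 hp
    exact hcut p h2 h3 h4 h5
  rw [this, Finset.card_empty] at h1
  simpa using h1

/-- Both values lie beyond the far end of [i, j], so each gets closer to its position by the full
distance j - i. -/
theorem SwapAt.cost_le_of_le {i j : ℤ} (h : SwapAt n g g' i j 1) (hg : IsSigned n g)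
    (hi : j ≤ g i) (hj : g j ≤ i)
    (hcut : ∀ p, i ≤ p → p < j → IsCut g' p → ¬ Odd (negs g' p)) :
    cost n g' + 2 * (shift j - 1 * shift i) ≤ cost n g := by
  have h1 := h.cost_le hg hcut
  have h2 := h.one_le
  have h3 := h.lt
  have hA : shift j ≤ shift (g i) := by
    rw [shift_of_pos (by omega), shift_of_pos (by omega)]; omega
  have hB : shift (g j) ≤ shift i := by
    simp only [shift]; split_ifs <;> omega
  have hij : shift i ≤ shift j := by
    rw [shift_of_pos (by omega), shift_of_pos (by omega)]; omega
  simp only [one_mul] at h1 ⊢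
  simp only [abs] at h1
  omega

/-- The gain comes from the cut alone. The value g p, with |g p| ≤ p, moves one step away from its
position and the negative value moves one step closer, so the displacement is unchanged while the
odd cut p disappears. -/
theorem SwapAt.cost_le_of_cut {p : ℤ} (h : SwapAt n g g' p (p + 1) 1) (hg : IsSigned n g)
    (hp : p ∈ oddCuts n g) (hneg : g (p + 1) < 0) :
    cost n g' + 2 * (shift (p + 1) - 1 * shift p) ≤ cost n g := by
  obtain ⟨h1, h2, h3, h4⟩ := mem_oddCuts.1 hp
  have hlt := hg.lt_abs_of_cut (by omega) h3 (by omega : p < p + 1)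
  have hp' : p ∉ oddCuts n g' := by
    intro hp'
    have := (mem_oddCuts.1 hp').2.2.1 p h1 le_rfl
    rw [h.abs_left] at this
    omega
  have hsub : insert p (oddCuts n g') ⊆ oddCuts n g := by
    intro q hq
    rcases Finset.mem_insert.1 hq with rfl | hq
    · exact hp
    · refine h.mem_oddCuts_of_mem hg ?_ hq
      by_contra hqp
      have : q = p := by omega
      exact hp' (this ▸ hq)
  have hcard := Finset.card_le_card hsub
  rw [Finset.card_insert_of_notMem hp'] at hcard
  have hd := h.disp_eq
  have hA := h3 p h1 le_rfl
  have hB : shift (g (p + 1)) ≤ 0 := by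
    simp only [shift]; split_ifs <;> omega
  have hA' : shift (g p) ≤ shift p := by
    have := le_abs_self (g p)
    simp only [shift]; split_ifs <;> omega
  rw [shift_of_pos (by omega : 0 < p)] at *
  rw [shift_of_pos (by omega : 0 < p + 1)] at *
  unfold cost
  simp only [one_mul] at *
  rw [hd]
  simp only [abs]
  omega

/-- Let p be the last odd cut. Since the total number of negative values is even, one occurs after
p; the first of them, at j, is brought to the left. -/
theorem exists_descent_of_oddCuts (hg : IsSigned n g) (heven : Even (negs g n))
    (hne : (oddCuts n g).Nonempty) : ∃ i j, 1 ≤ i ∧ i < j ∧ j ≤ n ∧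
      ∀ g', IsSigned n g' → SwapAt n g g' i j 1 →
        cost n g' + 2 * (shift j - 1 * shift i) ≤ cost n g := by
  set p := (oddCuts n g).max' hne with hpdef
  have hp : p ∈ oddCuts n g := Finset.max'_mem _ _
  have hmax : ∀ q ∈ oddCuts n g, q ≤ p := fun q hq => Finset.le_max' _ q hq
  obtain ⟨h1, h2, h3, h4⟩ := mem_oddCuts.1 hp
  have hex : ∃ j, (p < j ∧ j ≤ n) ∧ g j < 0 := by
    by_contra! hno
    have := negs_eq_of_pos (by omega) h2 (g := g) fun k hk hkn => by
      have := hno k ⟨hk, hkn⟩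
      have := hg.ne_zero (by omega : k ≠ 0)
      omega
    rw [this] at heven
    exact Nat.not_even_iff_odd.2 h4 heven
  obtain ⟨j, ⟨⟨hj1, hj2⟩, hj3⟩, hjmin⟩ := Int.exists_least_of_bdd (P := fun j => (p < j ∧ j ≤ n) ∧ g j < 0)
    ⟨p, fun z hz => hz.1.1.le⟩ hex
  have hpos : ∀ k, p < k → k < j → 0 < g k := by
    intro k hk hkj
    by_contra! hneg
    have := hg.ne_zero (by omega : k ≠ 0)
    have := hjmin k ⟨⟨hk, by omega⟩, by omega⟩
    omega
  by_cases hjp : j = p + 1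
  · subst hjp
    exact ⟨p, p + 1, h1, by omega, hj2, fun _ _ h => h.cost_le_of_cut hg hp hj3⟩
  -- Otherwise the positive values on (p, j) are all below j, and j - 1 is a later odd cut.
  have hexi : ∃ i, p < i ∧ i < j ∧ j ≤ g i := by
    by_contra! hno
    have hcut : j - 1 ∈ oddCuts n g := by
      refine mem_oddCuts.2 ⟨by omega, by omega, ?_, ?_⟩
      · intro k hk hkj
        by_cases hkp : k ≤ p
        · have := h3 k hk hkp
          omega
        · rw [abs_of_pos (hpos k (by omega) (by omega))]
          have := hno k (by omega) (by omega)
          omega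
      · rwa [negs_eq_of_pos (p := p) (by omega) (by omega) fun k hk hkj => hpos k hk (by omega)]
    have := hmax _ hcut
    omega
  obtain ⟨i, hi1, hi2, hi3⟩ := hexi
  refine ⟨i, j, by omega, hi2, hj2, fun g' hg' h => h.cost_le_of_le hg hi3 (by omega) ?_⟩
  intro q hq1 hq2 _
  -- Up to q there are the odd number of negative values on [1, p] and the one just moved to i, so a
  -- cut there is even.
  rw [negs_eq_succ (p := p) (i := i) (by omega) (by omega) (by omega)
    (by rw [h.left, one_mul]; exact hj3), h.negs_eq_of_lt hi1]
  · rw [Nat.not_odd_iff_even]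
    exact h4.add_one
  · intro k hk1 hk2 hk3
    rw [h.other k (by omega) (by omega) hk3 (by omega)]
    exact hpos k hk1 (by omega)

/-- Let i be the last position with g i > i, and swap it with the position j in (i, g i] that
carries the least value. -/
theorem exists_descent_of_lt (hg : IsSigned n g) (hno : oddCuts n g = ∅)
    (hex : ∃ i, (1 ≤ i ∧ i ≤ n) ∧ i < g i) : ∃ i j, 1 ≤ i ∧ i < j ∧ j ≤ n ∧
      ∀ g', IsSigned n g' → SwapAt n g g' i j 1 →
        cost n g' + 2 * (shift j - 1 * shift i) ≤ cost n g := by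
  obtain ⟨i, ⟨⟨hi1, hi2⟩, hi3⟩, himax⟩ := Int.exists_greatest_of_bdd
    (P := fun i => (1 ≤ i ∧ i ≤ n) ∧ i < g i) ⟨n, fun z hz => hz.1.2⟩ hex
  have hAn : g i ≤ n := (le_abs_self _).trans (hg.le i hi1 hi2)
  have hle : ∀ k, i < k → k ≤ n → g k ≤ k := by
    intro k hk hkn
    by_contra! hlt
    have := himax k ⟨⟨by omega, hkn⟩, hlt⟩
    omega
  obtain ⟨j, hj, hjmin⟩ := Finset.exists_min_image (Finset.Ioc i (g i)) g
    ⟨g i, Finset.mem_Ioc.2 ⟨hi3, le_rfl⟩⟩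
  rw [Finset.mem_Ioc] at hj
  have hji : g j ≤ i := by
    -- If all values on (i, g i] exceeded i, then g would permute this interval, because g k ≤ k
    -- past i, and the value g i would be taken twice.
    by_contra! hlt
    have := Finset.surjOn_of_injOn_of_card_le (s := Finset.Ioc i (g i)) (t := Finset.Ioc i (g i)) g
      (fun k hk => by
        have h1 := hjmin k hk
        have hk := Finset.mem_Ioc.1 hk
        have h2 := hle k hk.1 (by omega)
        exact Finset.mem_coe.2 (Finset.mem_Ioc.2 ⟨by omega, by omega⟩))
      hg.inj.injOn le_rfl
    obtain ⟨k, hk, hkm⟩ := this (Finset.mem_coe.2 (Finset.mem_Ioc.2 ⟨hi3, le_rfl⟩))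
    have hk := Finset.mem_Ioc.1 (Finset.mem_coe.1 hk)
    have := hg.inj hkm
    omega
  refine ⟨i, j, hi1, hj.1, by omega, fun g' hg' h => h.cost_le_of_le hg hj.2 hji ?_⟩
  intro p hp1 hp2 hc hodd
  have hBp : |g j| ≤ p := by
    have := hc i hi1 hp1
    rwa [h.abs_left] at this
  -- Beyond the cut p the absolute values exceed p ≥ |g j|, so a negative value would be smaller
  -- than the minimum g j.
  have hpos : ∀ k, p < k → k ≤ g i → k ≠ j → 0 < g k := by
    intro k hk1 hk2 hk3
    by_contra! hneg
    have h1 := hg'.lt_abs_of_cut (by omega) hc hk1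
    rw [h.other k (by omega) (by omega) (by omega) hk3, abs_of_nonpos hneg] at h1
    have h2 := hjmin k (Finset.mem_Ioc.2 ⟨by omega, hk2⟩)
    have h3 := neg_abs_le (g j)
    omega
  -- An odd cut p of g' in [i, j) would thus make `g i` an odd cut of g: g' has no negative value
  -- between p and `g i`, and the swap preserves the parity at `g i`.
  have hcut : g i ∈ oddCuts n g := by
    refine mem_oddCuts.2 ⟨by omega, hAn, ?_, ?_⟩
    · intro k hk1 hk2
      by_cases hki : k = i
      · subst hki
        rw [abs_of_pos (by omega)]
      by_cases hkj : k = j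
      · subst hkj; omega
      by_cases hkp : k ≤ p
      · have := hc k hk1 hkp
        rw [h.other k (by omega) (by omega) hki hkj] at this
        omega
      · have h1 := hpos k (by omega) hk2 hkj
        have h2 := hle k (by omega) (by omega)
        rw [abs_of_pos h1]
        omega
    · rw [← h.odd_negs_iff hg hj.2 hAn, negs_eq_of_pos (p := p) (by omega) (by omega)]
      · exact hodd
      · intro k hk1 hk2
        by_cases hkj : k = j
        · subst hkj
          rw [h.right]
          omega
        · rw [h.other k (by omega) (by omega) (by omega) hkj]
          exact hpos k hk1 hk2 hkj
  rw [hno] at hcut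
  exact absurd hcut (Finset.notMem_empty _)

theorem eq_self_of_pos_of_le (hg : IsSigned n g) {m : ℤ}
    (h : ∀ k, 1 ≤ k → k < m → 0 < g k ∧ g k ≤ k) : ∀ k, 1 ≤ k → k < m → g k = k := by
  have key : ∀ N : ℕ, ∀ k : ℤ, 1 ≤ k → k < m → k.toNat = N → g k = k := by
    intro N
    induction N using Nat.strong_induction_on with
    | _ N ih =>
      intro k h1 h2 hN
      obtain ⟨h3, h4⟩ := h k h1 h2
      by_contra hne
      have := hg.inj (ih (g k).toNat (by omega) (g k) (by omega) (by omega) rfl)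
      omega
  exact fun k h1 h2 => key _ k h1 h2 rfl

/-- Without values above their positions, g is the identity before its first negative value, at i.
The swap with ε = -1 makes this value and the next negative one positive. -/
theorem exists_descent_of_le (hg : IsSigned n g) (hno : oddCuts n g = ∅)
    (hle : ∀ k, 1 ≤ k → k ≤ n → g k ≤ k) (hne : ∃ k, 1 ≤ k ∧ k ≤ n ∧ g k ≠ k) :
    ∃ i j, 1 ≤ i ∧ i < j ∧ j ≤ n ∧
      ∀ g', IsSigned n g' → SwapAt n g g' i j (-1) →
        cost n g' + 2 * (shift j - (-1) * shift i) ≤ cost n g := by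
  have hex : ∃ i, (1 ≤ i ∧ i ≤ n) ∧ g i < 0 := by
    by_contra! hpos
    obtain ⟨k, h1, h2, h3⟩ := hne
    refine h3 (eq_self_of_pos_of_le hg (m := n + 1) (fun k h1 h2 => ⟨?_, hle k h1 (by omega)⟩)
      k h1 (by omega))
    have := hpos k ⟨h1, by omega⟩
    have := hg.ne_zero (by omega : k ≠ 0)
    omega
  obtain ⟨i, ⟨⟨hi1, hi2⟩, hi3⟩, himin⟩ := Int.exists_least_of_bdd
    (P := fun i => (1 ≤ i ∧ i ≤ n) ∧ g i < 0) ⟨1, fun z hz => hz.1.1⟩ hex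
  have hpos : ∀ k, 1 ≤ k → k < i → 0 < g k := by
    intro k h1 h2
    by_contra! hneg
    have := hg.ne_zero (by omega : k ≠ 0)
    have := himin k ⟨⟨h1, by omega⟩, by omega⟩
    omega
  have hid := eq_self_of_pos_of_le hg (m := i) fun k h1 h2 => ⟨hpos k h1 h2, hle k h1 (by omega)⟩
  have hge : ∀ k, i ≤ k → i ≤ |g k| := by
    have hc : IsCut g (i - 1) := fun k h1 h2 => by
      rw [hid k h1 (by omega), abs_of_pos (by omega)]; exact h2
    intro k hk
    have := hg.lt_abs_of_cut (by omega) hc (by omega : i - 1 < k)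
    omega
  have hA := hge i le_rfl
  have hAn := hg.le i hi1 hi2
  have hAi : |g i| = -g i := abs_of_neg hi3
  -- Otherwise |g i| is a cut with exactly one negative value before it, hence odd.
  have hexj : ∃ j, (i < j ∧ j ≤ |g i|) ∧ g j < 0 := by
    by_contra! hnn
    have hpos' : ∀ k, i < k → k ≤ |g i| → 0 < g k := by
      intro k h1 h2
      have := hnn k ⟨h1, h2⟩
      have := hg.ne_zero (by omega : k ≠ 0)
      omega
    have hcut : |g i| ∈ oddCuts n g := by
      refine mem_oddCuts.2 ⟨by omega, hAn, ?_, ?_⟩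
      · intro k h1 h2
        rcases lt_trichotomy k i with h | rfl | h
        · rw [hid k h1 h, abs_of_pos (by omega)]; exact h2
        · exact le_rfl
        · rw [abs_of_pos (hpos' k h h2)]
          have := hle k h1 (by omega)
          omega
      · rw [negs_eq_succ (p := 0) le_rfl (by omega) hA hi3, negs_zero]
        · exact odd_one
        · intro k h1 h2 h3
          rcases lt_or_gt_of_ne h3 with h | h
          · exact hpos k (by omega) h
          · exact hpos' k h h2
    rw [hno] at hcut
    exact absurd hcut (Finset.notMem_empty _)
  obtain ⟨j, ⟨⟨hj1, hj2⟩, hj3⟩, hjmin⟩ := Int.exists_least_of_bdd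
    (P := fun j => (i < j ∧ j ≤ |g i|) ∧ g j < 0) ⟨i, fun z hz => hz.1.1.le⟩ hexj
  refine ⟨i, j, hi1, hj1, by omega, fun g' hg' h => ?_⟩
  have hB := hge j hj1.le
  rw [abs_of_neg hj3] at hB
  -- After the swap there is no negative value before j, so no odd cut arises in [i, j).
  have hc := h.cost_le hg fun p h1 h2 _ => by
    rw [negs_eq_of_pos (p := 0) le_rfl (by omega), negs_zero]
    · simp
    · intro k hk1 hk2
      rcases lt_trichotomy k i with hk | rfl | hk
      · rw [h.other k (by omega) (by omega) (by omega) (by omega)]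
        exact hpos k (by omega) hk
      · rw [h.left]; omega
      · rw [h.other k (by omega) (by omega) (by omega) (by omega)]
        by_contra! hneg
        have := hg.ne_zero (by omega : k ≠ 0)
        have := hjmin k ⟨⟨hk, by omega⟩, by omega⟩
        omega
  -- As |g j| ≥ i and |g i| ≥ j, removing both signs lowers the displacement by exactly 2(i - 1) +
  -- 2(j - 1).
  have e1 : shift (g i) = g i + 1 := by simp only [shift]; split_ifs <;> omega
  have e2 : shift (g j) = g j + 1 := by simp only [shift]; split_ifs <;> omega
  rw [shift_of_pos (by omega : 0 < -1 * g j), shift_of_pos (by omega : 0 < -1 * g i),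
    shift_of_pos (by omega : 0 < i), shift_of_pos (by omega : 0 < j), e1, e2] at hc
  rw [shift_of_pos (by omega : 0 < i), shift_of_pos (by omega : 0 < j)]
  simp only [abs] at hc hj2
  omega

theorem exists_descent (hg : IsSigned n g) (heven : Even (negs g n))
    (hne : ∃ k, 1 ≤ k ∧ k ≤ n ∧ g k ≠ k) : ∃ i j ε, 1 ≤ i ∧ i < j ∧ j ≤ n ∧ (ε = 1 ∨ ε = -1) ∧
      ∀ g', IsSigned n g' → SwapAt n g g' i j ε →
        cost n g' + 2 * (shift j - ε * shift i) ≤ cost n g := by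
  rcases (oddCuts n g).eq_empty_or_nonempty with hno | hcut
  · by_cases hex : ∃ i, (1 ≤ i ∧ i ≤ n) ∧ i < g i
    · obtain ⟨i, j, h1, h2, h3, h4⟩ := exists_descent_of_lt hg hno hex
      exact ⟨i, j, 1, h1, h2, h3, Or.inl rfl, h4⟩
    · push Not at hex
      obtain ⟨i, j, h1, h2, h3, h4⟩ :=
        exists_descent_of_le hg hno (fun k h1 h2 => hex k ⟨h1, h2⟩) hne
      exact ⟨i, j, -1, h1, h2, h3, Or.inr rfl, h4⟩
  · obtain ⟨i, j, h1, h2, h3, h4⟩ := exists_descent_of_oddCuts hg heven hcut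
    exact ⟨i, j, 1, h1, h2, h3, Or.inl rfl, h4⟩

end SignedPerm

/-! ### Blocks and cuts: the D-oddness counts the odd cuts -/

namespace SignedPerm

theorem val_of_notMem {n : ℕ} (w : Equiv.Perm (punctured n)) {i : ℤ} (hi : i ∉ punctured n) :
    val w i = i := Equiv.Perm.ofSubtype_apply_of_not_mem w hi

theorem isSigned_val {n : ℕ} {w : Equiv.Perm (punctured n)} (hw : w ∈ groupB n) :
    IsSigned n (val w) where
  inj := val_injective w
  odd := fun i => by
    by_cases hi : i ∈ punctured n
    · exact hw i hi
    · have hi' : -i ∉ punctured n := by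
        rw [mem_punctured] at hi ⊢; omega
      rw [val_of_notMem w hi, val_of_notMem w hi']
  le := fun i h1 h2 => by
    have := mem_punctured.1 (val_mem w (mem_punctured.2 ⟨by omega, by omega, h2⟩))
    rw [abs_le]
    exact this.2

theorem neg_eq_negs {n : ℕ} (w : Equiv.Perm (punctured n)) : neg w = negs (val w) n := rfl

theorem exists_groupB {n : ℕ} (f : ℤ → ℤ) (hmem : ∀ i ∈ punctured n, f i ∈ punctured n)
    (hinj : ∀ i ∈ punctured n, ∀ j ∈ punctured n, f i = f j → i = j)
    (hodd : ∀ i ∈ punctured n, f (-i) = -f i) :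
    ∃ u : groupB n, ∀ i ∈ punctured n, val u.1 i = f i := by
  let F : punctured n → punctured n := fun i => ⟨f i, hmem i i.2⟩
  have hF : Function.Injective F := fun i j h =>
    Subtype.ext (hinj i i.2 j j.2 (congrArg Subtype.val h))
  let u : Equiv.Perm (punctured n) := Equiv.ofBijective F (Finite.injective_iff_bijective.1 hF)
  have hu : ∀ i ∈ punctured n, val u i = f i := fun i hi => val_coe u ⟨i, hi⟩
  refine ⟨⟨u, fun i hi => ?_⟩, hu⟩
  rw [hu i hi, hu (-i) (by rw [mem_punctured] at hi ⊢; omega), hodd i hi]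

theorem exists_isDirectSum {n p : ℕ} (w : groupB n) (hpn : p ≤ n) (hp : IsCut (val w.1) p) :
    ∃ (u : groupB p) (v : groupB (n - p)), IsDirectSum u v w := by
  have hw := isSigned_val w.2
  have habs : ∀ i : ℤ, i ≠ 0 → |i| ≤ p → |val w.1 i| ≤ p := by
    intro i h0 hi
    rcases lt_or_gt_of_ne h0 with h | h
    · have := hw.odd i
      rw [← abs_neg, ← this]
      rw [abs_of_neg h] at hi
      exact hp _ (by omega) hi
    · rw [abs_of_pos h] at hi
      exact hp _ (by omega) hi
  have hlarge : ∀ i : ℤ, (p : ℤ) < |i| → |i| ≤ n → (p : ℤ) < |val w.1 i| ∧ |val w.1 i| ≤ n := by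
    intro i hi hi'
    rcases abs_cases i with h | h
    · exact ⟨hw.lt_abs_of_cut (by omega) hp (by omega), hw.le _ (by omega) (by omega)⟩
    · rw [← abs_neg (val w.1 i), ← hw.odd i]
      exact ⟨hw.lt_abs_of_cut (by omega) hp (by omega), hw.le _ (by omega) (by omega)⟩
  obtain ⟨u, hu⟩ := exists_groupB (n := p) (val w.1)
    (fun i hi => by
      have hi := mem_punctured.1 hi
      have h1 := habs i hi.1 (abs_le.2 hi.2)
      have h2 := hw.ne_zero hi.1
      exact mem_punctured.2 ⟨h2, abs_le.1 h1⟩)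
    (fun i _ j _ h => hw.inj h) (fun i _ => hw.odd i)
  -- The right summand is the restriction of w to absolute values above p, transported by `up` and
  -- `down`, which change absolute values by p and keep signs.
  let up : ℤ → ℤ := fun i => if 0 < i then i + p else i - p
  let down : ℤ → ℤ := fun i => if 0 < i then i - p else i + p
  have hup : ∀ i ∈ punctured (n - p), (p : ℤ) < |up i| ∧ |up i| ≤ n := by
    intro i hi
    have hi := mem_punctured.1 hi
    simp only [up]
    split_ifs
    · rw [abs_of_pos (by omega)]; omega
    · rw [abs_of_neg (by omega)]; omega
  obtain ⟨v, hv⟩ := exists_groupB (n := n - p) (fun i => down (val w.1 (up i)))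
    (fun i hi => by
      have h1 := hlarge _ (hup i hi).1 (hup i hi).2
      rw [mem_punctured]
      simp only [down]
      rcases abs_cases (val w.1 (up i)) with h | h <;> split_ifs <;> omega)
    (fun i hi j hj h => by
      have h1 := hlarge _ (hup i hi).1 (hup i hi).2
      have h2 := hlarge _ (hup j hj).1 (hup j hj).2
      have h3 : val w.1 (up i) = val w.1 (up j) := by
        simp only [down] at h
        rcases abs_cases (val w.1 (up i)) with h | h <;>
          rcases abs_cases (val w.1 (up j)) with h | h <;> split_ifs at * <;> omega
      have h4 := hw.inj h3
      have hi := mem_punctured.1 hi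
      have hj := mem_punctured.1 hj
      simp only [up] at h4
      split_ifs at h4 <;> omega)
    (fun i hi => by
      have h1 := hlarge _ (hup i hi).1 (hup i hi).2
      have hi := mem_punctured.1 hi
      have : up (-i) = -up i := by
        simp only [up]; split_ifs <;> omega
      rw [this, hw.odd]
      simp only [down]
      rcases abs_cases (val w.1 (up i)) with h | h <;> split_ifs <;> omega)
  refine ⟨u, v, by omega, fun i hi => ?_, fun i hi => ?_⟩
  · have hi := Finset.mem_Icc.1 hi
    exact (hu i (mem_punctured.2 (by omega))).symm
  · have hi := Finset.mem_Icc.1 hi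
    rw [hv _ (mem_punctured.2 (by omega))]
    have e : up (i - p) = i := by simp only [up]; split_ifs <;> omega
    rw [e]
    have h1 := hlarge i (by rw [abs_of_pos (by omega)]; omega) (by rw [abs_of_pos (by omega)]; omega)
    simp only [down]
    rcases abs_cases (val w.1 i) with h | h
    · rw [if_pos (by omega), Int.sign_eq_one_of_pos (by omega), abs_of_pos (by omega)]; ring
    · rw [if_neg (by omega), Int.sign_eq_neg_one_of_neg (by omega), abs_of_neg (by omega)]; ring

open Classical in
/-- The cuts `p ∈ [1, n]` of `g`; if `e` holds, only those with an even number of negative values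
on `[1, p]`. -/
noncomputable def cuts (e : Prop) (n : ℤ) (g : ℤ → ℤ) : Finset ℤ :=
  (Finset.Icc 1 n).filter (fun p => IsCut g p ∧ (e → Even (negs g p)))

theorem mem_cuts {e : Prop} {n : ℤ} {g : ℤ → ℤ} {p : ℤ} :
    p ∈ cuts e n g ↔ 1 ≤ p ∧ p ≤ n ∧ IsCut g p ∧ (e → Even (negs g p)) := by
  simp [cuts, and_assoc]

theorem card_oddCuts (n : ℤ) (g : ℤ → ℤ) :
    ((oddCuts n g).card : ℤ) = (cuts False n g).card - (cuts True n g).card := by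
  have h : cuts False n g = oddCuts n g ∪ cuts True n g := by
    ext p
    have := Nat.even_or_odd (negs g p)
    simp only [mem_cuts, Finset.mem_union, mem_oddCuts]
    tauto
  have hd : Disjoint (oddCuts n g) (cuts True n g) := by
    rw [Finset.disjoint_left]
    intro p h1 h2
    exact Nat.not_even_iff_odd.2 (mem_oddCuts.1 h1).2.2.2 ((mem_cuts.1 h2).2.2.2 trivial)
  rw [h, Finset.card_union_of_disjoint hd]
  push_cast
  ring

/-- `w` is a nontrivial direct sum of signed permutations, even ones if `e` holds. -/
def Decomposable (e : Prop) {n : ℕ} (w : groupB n) : Prop :=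
  ∃ (k l : ℕ) (u : groupB k) (v : groupB l), 1 ≤ k ∧ 1 ≤ l ∧
    (e → u.1 ∈ groupD k) ∧ (e → v.1 ∈ groupD l) ∧ IsDirectSum u v w

namespace IsDirectSum

variable {k l n : ℕ} {u : groupB k} {v : groupB l} {w : groupB n}

theorem abs_val_add (h : IsDirectSum u v w) {i : ℤ} (h1 : 1 ≤ i) (h2 : i ≤ l) :
    |val w.1 (k + i)| = |val v.1 i| + k := by
  have := h.2.2 (k + i) (Finset.mem_Icc.2 (by omega))
  rw [this, add_sub_cancel_left, abs_mul, Int.abs_sign_of_ne_zero, one_mul,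
    abs_of_nonneg (by positivity)]
  exact (isSigned_val v.2).ne_zero (by omega)

theorem val_add_neg_iff (h : IsDirectSum u v w) {i : ℤ} (h1 : 1 ≤ i) (h2 : i ≤ l) :
    val w.1 (k + i) < 0 ↔ val v.1 i < 0 := by
  have := h.2.2 (k + i) (Finset.mem_Icc.2 (by omega))
  rw [this, add_sub_cancel_left]
  have h0 := (isSigned_val v.2).ne_zero (by omega : i ≠ 0)
  have hk := abs_nonneg (val v.1 i)
  have h1 := (isSigned_val v.2).one_le_abs h1
  rcases lt_or_gt_of_ne h0 with h | h
  · rw [Int.sign_eq_neg_one_of_neg h]; omega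
  · rw [Int.sign_eq_one_of_pos h]; omega

theorem isCut_left (h : IsDirectSum u v w) {p : ℤ} (hp : p ≤ k) :
    IsCut (val w.1) p ↔ IsCut (val u.1) p := by
  refine forall_congr' fun i => forall_congr' fun h1 => forall_congr' fun h2 => ?_
  rw [h.2.1 i (Finset.mem_Icc.2 (by omega))]

theorem isCut_add (h : IsDirectSum u v w) {q : ℤ} (h0 : 0 ≤ q) (hq : q ≤ l) :
    IsCut (val w.1) (k + q) ↔ IsCut (val v.1) q := by
  constructor
  · intro hc i h1 h2
    have := hc (k + i) (by omega) (by omega)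
    rw [h.abs_val_add h1 (by omega)] at this
    omega
  · intro hc i h1 h2
    by_cases hik : i ≤ k
    · rw [h.2.1 i (Finset.mem_Icc.2 (by omega))]
      have := (isSigned_val u.2).le i h1 hik
      omega
    · have e : i = k + (i - k) := by ring
      rw [e, h.abs_val_add (by omega) (by omega)]
      have := hc (i - k) (by omega) (by omega)
      omega

theorem negs_left (h : IsDirectSum u v w) {p : ℤ} (hp : p ≤ k) :
    negs (val w.1) p = negs (val u.1) p :=
  negs_congr fun i h1 h2 => h.2.1 i (Finset.mem_Icc.2 (by omega))

theorem negs_add (h : IsDirectSum u v w) {q : ℤ} (h0 : 0 ≤ q) (hq : q ≤ l) :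
    negs (val w.1) (k + q) = negs (val u.1) k + negs (val v.1) q := by
  rw [negs_split _ (by omega : (0 : ℤ) ≤ k) (by omega), h.negs_left le_rfl]
  congr 1
  symm
  refine Finset.card_nbij (fun i => k + i) ?_ (fun i _ j _ h => by simpa using h) ?_
  · intro i hi
    simp only [Finset.mem_coe, Finset.mem_filter, Finset.mem_Icc, Finset.mem_Ioc] at hi ⊢
    rw [h.val_add_neg_iff hi.1.1 (by omega)]
    exact ⟨by omega, hi.2⟩
  · intro i hi
    simp only [Finset.mem_coe, Finset.mem_filter, Finset.mem_Ioc] at hi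
    refine ⟨i - k, ?_, by simp⟩
    simp only [Finset.mem_coe, Finset.mem_filter, Finset.mem_Icc]
    have := h.val_add_neg_iff (i := i - k) (by omega) (by omega)
    rw [add_sub_cancel] at this
    exact ⟨by omega, this.1 hi.2⟩

/-- Taking `e` to be `False` or `True` treats types B and D together. In type D the left summand
must be even, so that translating a cut by k preserves its parity. -/
theorem cuts_eq (h : IsDirectSum u v w) {e : Prop} (hu : e → u.1 ∈ groupD k) :
    cuts e n (val w.1) = cuts e k (val u.1) ∪ (cuts e l (val v.1)).image (fun q => (k : ℤ) + q) := by
  have hn := h.1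
  have hu' : e → Even (negs (val u.1) k) := fun he => (hu he).2
  ext p
  rw [Finset.mem_union, Finset.mem_image]
  by_cases hp : p ≤ k
  · have : ¬ ∃ a ∈ cuts e l (val v.1), (k : ℤ) + a = p := by
      rintro ⟨a, ha, hap⟩
      have := (mem_cuts.1 ha).1
      omega
    rw [or_iff_left this, mem_cuts, mem_cuts, h.isCut_left hp, h.negs_left hp]
    have : p ≤ n := by omega
    simp only [this, hp, true_and]
  · have h1 : p ∉ cuts e k (val u.1) := fun hm => hp (mem_cuts.1 hm).2.1
    rw [or_iff_right h1]
    have key : ∀ q, 1 ≤ q → q ≤ (l : ℤ) →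
        (IsCut (val w.1) (k + q) ∧ (e → Even (negs (val w.1) (k + q))) ↔
          IsCut (val v.1) q ∧ (e → Even (negs (val v.1) q))) := by
      intro q hq0 hq
      rw [h.isCut_add (by omega) hq, h.negs_add (by omega) hq, Nat.even_add]
      exact and_congr_right fun _ => forall_congr' fun he => by simp [hu' he]
    constructor
    · intro hm
      obtain ⟨h1, h2, h3⟩ := mem_cuts.1 hm
      refine ⟨p - k, mem_cuts.2 ⟨by omega, by omega, ?_⟩, by ring⟩
      rw [← key _ (by omega) (by omega), add_sub_cancel]
      exact h3
    · rintro ⟨q, hq, rfl⟩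
      obtain ⟨h1, h2, h3⟩ := mem_cuts.1 hq
      exact mem_cuts.2 ⟨by omega, by omega, (key q h1 h2).2 h3⟩

theorem card_cuts (h : IsDirectSum u v w) {e : Prop} (hu : e → u.1 ∈ groupD k) :
    (cuts e n (val w.1)).card = (cuts e k (val u.1)).card + (cuts e l (val v.1)).card := by
  rw [h.cuts_eq hu, Finset.card_union_of_disjoint, Finset.card_image_of_injective]
  · exact add_right_injective _
  · rw [Finset.disjoint_left]
    intro p h1 h2
    obtain ⟨q, hq, rfl⟩ := Finset.mem_image.1 h2
    have := (mem_cuts.1 h1).2.1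
    have := (mem_cuts.1 hq).1
    omega

theorem left_mem_groupD (h : IsDirectSum u v w) (he : Even (negs (val w.1) k)) :
    u.1 ∈ groupD k := ⟨u.2, by rw [neg_eq_negs, ← h.negs_left le_rfl]; exact he⟩

theorem right_mem_groupD (h : IsDirectSum u v w) (hu : u.1 ∈ groupD k) (hw : w.1 ∈ groupD n) :
    v.1 ∈ groupD l := by
  refine ⟨v.2, ?_⟩
  have h1 := hw.2
  have h2 := hu.2
  rw [neg_eq_negs] at h1 h2 ⊢
  have h3 := h.negs_add (by omega : (0 : ℤ) ≤ l) le_rfl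
  have hn : (n : ℤ) = k + l := by have := h.1; omega
  rw [hn, h3, Nat.even_add] at h1
  exact h1.1 h2

end IsDirectSum

theorem self_mem_cuts {e : Prop} {n : ℕ} {w : groupB n} (hn : 1 ≤ n) (hw : e → w.1 ∈ groupD n) :
    (n : ℤ) ∈ cuts e n (val w.1) :=
  mem_cuts.2 ⟨by omega, le_rfl, (isSigned_val w.2).isCut_self, fun he => (hw he).2⟩

theorem decomposable_iff {e : Prop} {n : ℕ} {w : groupB n} (hw : e → w.1 ∈ groupD n) :
    Decomposable e w ↔ ∃ p ∈ cuts e n (val w.1), p < n := by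
  constructor
  · rintro ⟨k, l, u, v, hk, hl, hu, hv, h⟩
    refine ⟨k, ?_, by have := h.1; omega⟩
    rw [h.cuts_eq hu]
    exact Finset.mem_union_left _ (self_mem_cuts hk hu)
  · rintro ⟨p, hp, hpn⟩
    obtain ⟨h1, h2, h3, h4⟩ := mem_cuts.1 hp
    lift p to ℕ using by omega
    obtain ⟨u, v, h⟩ := exists_isDirectSum w (by omega) h3
    have hu : e → u.1 ∈ groupD p := fun he => h.left_mem_groupD (h4 he)
    exact ⟨p, n - p, u, v, by omega, by omega, hu,
      fun he => h.right_mem_groupD (hu he) (hw he), h⟩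

/-- The full size counts as a cut, so an indecomposable summand contributes exactly one. -/
theorem length_eq_card_cuts {e : Prop} {L : List (Σ k : ℕ, groupB k)} {n : ℕ} {w : groupB n}
    (h : IsSumOf L w)
    (hL : ∀ x ∈ L, 1 ≤ x.1 ∧ (e → x.2.1 ∈ groupD x.1) ∧ ¬ Decomposable e x.2) :
    L.length = (cuts e n (val w.1)).card := by
  induction h with
  | nil w => simp [cuts]
  | @cons k l n u v w L _ hs ih =>
    obtain ⟨h1, h2, h3⟩ : 1 ≤ k ∧ (e → u.1 ∈ groupD k) ∧ ¬ Decomposable e u :=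
      hL ⟨k, u⟩ List.mem_cons_self
    rw [List.length_cons, ih fun x hx => hL x (List.mem_cons_of_mem _ hx), hs.card_cuts h2,
      add_comm]
    congr 1
    symm
    rw [Finset.card_eq_one]
    refine ⟨k, Finset.eq_singleton_iff_unique_mem.2 ⟨self_mem_cuts h1 h2, fun p hp => ?_⟩⟩
    by_contra hne
    have := (mem_cuts.1 hp).2.1
    exact h3 ((decomposable_iff h2).2 ⟨p, hp, by omega⟩)

theorem exists_decomposition {e : Prop} (n : ℕ) : ∀ (w : groupB n), (e → w.1 ∈ groupD n) →
    ∃ L, IsSumOf L w ∧ ∀ x ∈ L, 1 ≤ x.1 ∧ (e → x.2.1 ∈ groupD x.1) ∧ ¬ Decomposable e x.2 := by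
  induction n using Nat.strong_induction_on with
  | _ n ih =>
    intro w hw
    rcases Nat.eq_zero_or_pos n with rfl | hn
    · exact ⟨[], IsSumOf.nil w, by simp⟩
    have hne : (cuts e n (val w.1)).Nonempty := ⟨n, self_mem_cuts hn hw⟩
    -- Minimality of the cut makes the summand split off on the left indecomposable.
    obtain ⟨p, hp, hmin⟩ : ∃ p ∈ cuts e n (val w.1), ∀ q ∈ cuts e n (val w.1), p ≤ q :=
      ⟨_, Finset.min'_mem _ hne, Finset.min'_le _⟩
    obtain ⟨h1, h2, h3, h4⟩ := mem_cuts.1 hp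
    lift p to ℕ using by omega
    obtain ⟨u, v, h⟩ := exists_isDirectSum w (by omega) h3
    have hu : e → u.1 ∈ groupD p := fun he => h.left_mem_groupD (h4 he)
    obtain ⟨L, hL1, hL2⟩ := ih (n - p) (by omega) v fun he => h.right_mem_groupD (hu he) (hw he)
    refine ⟨⟨p, u⟩ :: L, IsSumOf.cons u v w L hL1 h, fun x hx => ?_⟩
    rcases List.mem_cons.1 hx with rfl | hx
    · refine ⟨by simp only; omega, hu, ?_⟩
      rw [decomposable_iff hu]
      rintro ⟨q, hq, hqp⟩
      have := hmin q (by rw [h.cuts_eq hu]; exact Finset.mem_union_left _ hq)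
      omega
    · exact hL2 x hx

/-- All decompositions have the same length, but one must exist, since `sInf ∅ = 0`. -/
theorem sInf_eq_of_forall_eq {S : Set ℕ} {c : ℕ} (hne : S.Nonempty) (h : ∀ m ∈ S, m = c) :
    sInf S = c := h _ (Nat.sInf_mem hne)

theorem numBlocksB_eq {n : ℕ} (w : groupB n) : numBlocksB w = (cuts False n (val w.1)).card := by
  have key : ∀ x : (Σ k : ℕ, groupB k), (1 ≤ x.1 ∧ ¬ DecomposableB x.2) ↔
      (1 ≤ x.1 ∧ (False → x.2.1 ∈ groupD x.1) ∧ ¬ Decomposable False x.2) := by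
    intro x; simp [Decomposable, DecomposableB]
  refine sInf_eq_of_forall_eq ?_ ?_
  · obtain ⟨L, h1, h2⟩ := exists_decomposition (e := False) n w (by simp)
    exact ⟨_, L, ⟨h1, fun x hx => (key x).2 (h2 x hx)⟩, rfl⟩
  · rintro m ⟨L, ⟨h1, h2⟩, rfl⟩
    exact length_eq_card_cuts h1 fun x hx => (key x).1 (h2 x hx)

theorem numBlocksD_eq {n : ℕ} (w : groupB n) (hw : w.1 ∈ groupD n) :
    numBlocksD w = (cuts True n (val w.1)).card := by
  have key : ∀ x : (Σ k : ℕ, groupB k), (1 ≤ x.1 ∧ x.2.1 ∈ groupD x.1 ∧ ¬ DecomposableD x.2) ↔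
      (1 ≤ x.1 ∧ (True → x.2.1 ∈ groupD x.1) ∧ ¬ Decomposable True x.2) := by
    intro x; simp [Decomposable, DecomposableD]
  refine sInf_eq_of_forall_eq ?_ ?_
  · obtain ⟨L, h1, h2⟩ := exists_decomposition (e := True) n w (fun _ => hw)
    exact ⟨_, L, ⟨h1, fun x hx => (key x).2 (h2 x hx)⟩, rfl⟩
  · rintro m ⟨L, ⟨h1, h2⟩, rfl⟩
    exact length_eq_card_cuts h1 fun x hx => (key x).1 (h2 x hx)

theorem oddnessD_eq {n : ℕ} (w : groupD n) : oddnessD w = (oddCuts n (val w.1)).card := by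
  rw [oddnessD, numBlocksB_eq, numBlocksD_eq (toB w) w.2, card_oddCuts]
  rfl

end SignedPerm

/-! ### Roots, heights and reflections of type D -/

namespace SignedPerm

variable {n : ℕ}

theorem basisVec_neg (a : ℤ) : basisVec n (-a) = -basisVec n a := by
  ext k
  simp only [basisVec, Pi.neg_apply]
  split_ifs <;> first | omega | norm_num

theorem basisVec_succ (k : Fin n) : basisVec n ((k : ℤ) + 1) = Pi.single k 1 := by
  ext m
  simp only [basisVec, Pi.single_apply, Fin.ext_iff]
  split_ifs <;> first | omega | rfl

theorem act_add (w : groupD n) (x y : Fin n → ℝ) : act w (x + y) = act w x + act w y := by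
  simp [act, add_smul, Finset.sum_add_distrib]

theorem act_neg (w : groupD n) (x : Fin n → ℝ) : act w (-x) = -act w x := by
  simp [act]

theorem act_sub (w : groupD n) (x y : Fin n → ℝ) : act w (x - y) = act w x - act w y := by
  rw [sub_eq_add_neg, act_add, act_neg, sub_eq_add_neg]

theorem act_basisVec (w : groupD n) {a : ℤ} (ha : a ∈ punctured n) :
    act w (basisVec n a) = basisVec n (val w.1 a) := by
  have key : ∀ k : Fin n, act w (basisVec n ((k : ℤ) + 1)) = basisVec n (val w.1 ((k : ℤ) + 1)) := by
    intro k
    rw [basisVec_succ]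
    simp [act, Pi.single_apply]
  have ha' := mem_punctured.1 ha
  rcases lt_or_gt_of_ne ha'.1 with h | h
  · have e : a = -((⟨(-a - 1).toNat, by omega⟩ : Fin n) + 1 : ℤ) := by simp only; omega
    rw [e, basisVec_neg, act_neg, key, (isSigned_val w.2.1).odd, basisVec_neg]
  · have e : a = ((⟨(a - 1).toNat, by omega⟩ : Fin n) + 1 : ℤ) := by simp only; omega
    rw [e, key]

/-- The functional that takes the value `1` on every simple root. -/
noncomputable def height : (Fin n → ℝ) →ₗ[ℝ] ℝ where
  toFun x := ∑ k : Fin n, x k * (k : ℝ)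
  map_add' x y := by simp [add_mul, Finset.sum_add_distrib]
  map_smul' c x := by simp [mul_assoc, Finset.mul_sum]

theorem height_basisVec {a : ℤ} (ha : a ∈ punctured n) : height (basisVec n a) = shift a := by
  have key : ∀ k : Fin n, height (basisVec n ((k : ℤ) + 1)) = k := by
    intro k
    rw [basisVec_succ]
    simp [height, Pi.single_apply]
  have ha' := mem_punctured.1 ha
  rcases lt_or_gt_of_ne ha'.1 with h | h
  · have e : a = -((⟨(-a - 1).toNat, by omega⟩ : Fin n) + 1 : ℤ) := by simp only; omega
    have hs : shift a = -((-a - 1).toNat : ℤ) := by simp only [shift]; split_ifs <;> omega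
    rw [hs, e, basisVec_neg, map_neg, key]
    simp
  · have e : a = ((⟨(a - 1).toNat, by omega⟩ : Fin n) + 1 : ℤ) := by simp only; omega
    have hs : shift a = ((a - 1).toNat : ℤ) := by rw [shift_of_pos h]; omega
    rw [hs, e, key]
    simp

/-- The vector `e_b - e_a`. -/
def rootVec (n : ℕ) (a b : ℤ) : Fin n → ℝ := basisVec n b - basisVec n a

theorem simpleRoot_eq (p : SimpleIdx n) : simpleRoot p = rootVec n p.1.1 p.1.2 := rfl

theorem rootVec_neg_neg (a b : ℤ) : rootVec n (-b) (-a) = rootVec n a b := by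
  simp only [rootVec, basisVec_neg]; abel

theorem neg_rootVec (a b : ℤ) : -rootVec n a b = rootVec n b a := by
  simp only [rootVec]; abel

theorem act_rootVec (w : groupD n) {a b : ℤ} (ha : a ∈ punctured n) (hb : b ∈ punctured n) :
    act w (rootVec n a b) = rootVec n (val w.1 a) (val w.1 b) := by
  rw [rootVec, act_sub, act_basisVec w ha, act_basisVec w hb, rootVec]

theorem height_rootVec {a b : ℤ} (ha : a ∈ punctured n) (hb : b ∈ punctured n) :
    height (rootVec n a b) = ((shift b - shift a : ℤ) : ℝ) := by
  rw [rootVec, map_sub, height_basisVec ha, height_basisVec hb]; push_cast; rfl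

theorem simpleIdx_cases (p : SimpleIdx n) : ((p.1.1 : ℤ) = -1 ∧ (p.1.2 : ℤ) = 2) ∨
    (1 ≤ (p.1.1 : ℤ) ∧ (p.1.2 : ℤ) = p.1.1 + 1) := p.2

theorem height_simpleRoot (p : SimpleIdx n) : height (simpleRoot p) = 1 := by
  rw [simpleRoot_eq, height_rootVec p.1.1.2 p.1.2.2]
  have : shift (p.1.2 : ℤ) - shift (p.1.1 : ℤ) = 1 := by
    rcases simpleIdx_cases p with ⟨h1, h2⟩ | ⟨h1, h2⟩
    · rw [h1, h2]; decide
    · rw [shift_of_pos (by omega), shift_of_pos (by omega)]; omega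
  rw [this]; norm_num

theorem height_nonneg {β : Fin n → ℝ} (h : β ∈ posRoots n) : 0 ≤ height β := by
  obtain ⟨-, c, hc, rfl⟩ := h
  rw [map_sum]
  refine Finset.sum_nonneg fun p _ => ?_
  rw [map_smul, height_simpleRoot, smul_eq_mul, mul_one]
  exact hc p

/-- `t` is the signed permutation `(a, b)(-a, -b)`. -/
def IsSignedSwap (t : Equiv.Perm (punctured n)) (a b : ℤ) : Prop :=
  ∀ i ∈ punctured n, val t i =
    if i = a then b else if i = b then a else if i = -a then -b else if i = -b then -a else i

theorem neg_mem_punctured {a : ℤ} (ha : a ∈ punctured n) : -a ∈ punctured n := by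
  rw [mem_punctured] at ha ⊢; omega

theorem isSignedSwap_simple (p : SimpleIdx n) : IsSignedSwap (simple p).1 p.1.1 p.1.2 :=
  fun i hi => (val_coe _ ⟨i, hi⟩).trans (simplePerm_apply p ⟨i, hi⟩)

theorem IsSignedSwap.neg_neg {t : Equiv.Perm (punctured n)} {a b : ℤ} (h : IsSignedSwap t a b) :
    IsSignedSwap t (-b) (-a) := by
  intro i hi
  have := (mem_punctured.1 hi).1
  rw [h i hi]
  split_ifs <;> omega

theorem IsSignedSwap.mul_self {t : groupD n} {a b : ℤ} (h : IsSignedSwap t.1 a b)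
    (ha : a ∈ punctured n) (hb : b ∈ punctured n) (hab : a ≠ b) : t * t = 1 := by
  apply Subtype.ext
  ext i
  have hm : (((t * t).1 i : punctured n) : ℤ) = val t.1 (val t.1 i) := by
    rw [← val_mul]; exact (val_coe _ i).symm
  rw [hm]
  change val t.1 _ = (i : ℤ)
  have ho := (isSigned_val t.2.1).odd
  have h1 : val t.1 a = b := by rw [h a ha, if_pos rfl]
  have h2 : val t.1 b = a := by rw [h b hb, if_neg hab.symm, if_pos rfl]
  have h5 := h i i.2
  split_ifs at h5 with c1 c2 c3 c4
  · rw [h5, h2, c1]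
  · rw [h5, h1, c2]
  · rw [h5, ho, h2, c3]
  · rw [h5, ho, h1, c4]
  · rw [h5, h5]

theorem IsSignedSwap.conj {t u : groupD n} {a b : ℤ} (h : IsSignedSwap t.1 a b) :
    IsSignedSwap (u * t * u⁻¹).1 (val u.1 a) (val u.1 b) := by
  intro i hi
  have hx : val u⁻¹.1 i ∈ punctured n := val_mem _ hi
  have hi' : i = val u.1 (val u⁻¹.1 i) := by
    rw [← val_mul]
    simp [val_one]
  have e : val (u * t * u⁻¹).1 i = val u.1 (val t.1 (val u⁻¹.1 i)) := by
    rw [← val_mul, ← val_mul]; rfl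
  rw [e, h _ hx]
  generalize val u⁻¹.1 i = x at *
  subst hi'
  have ho := (isSigned_val u.2.1).odd
  simp only [← ho, (val_injective u.1).eq_iff]
  split_ifs <;> rfl

theorem exists_simpleIdx {a b : ℤ} (ha : a ∈ punctured n) (hb : b ∈ punctured n)
    (h : (a = -1 ∧ b = 2) ∨ (1 ≤ a ∧ b = a + 1)) :
    ∃ p : SimpleIdx n, (p.1.1 : ℤ) = a ∧ (p.1.2 : ℤ) = b :=
  ⟨⟨(⟨a, ha⟩, ⟨b, hb⟩), h⟩, rfl, rfl⟩

/-- A simple reflection changes each of `shift a` and `shift b` by at most 1. A drop of 2 in the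
height needs both to move unfavourably, which happens only if b = -a or the root is the simple root
itself, of height 1. -/
theorem shift_sub_le_simple {p : SimpleIdx n} {a b : ℤ} (ha : a ∈ punctured n)
    (hb : b ∈ punctured n) (hab : a ≠ -b) (h : 2 ≤ shift b - shift a) :
    shift b - shift a - 1 ≤ shift (val (simple p).1 b) - shift (val (simple p).1 a) := by
  rw [isSignedSwap_simple p a ha, isSignedSwap_simple p b hb]
  have hp := simpleIdx_cases p
  have ha := (mem_punctured.1 ha).1
  have hb := (mem_punctured.1 hb).1
  generalize (p.1.1 : ℤ) = x at *
  generalize (p.1.2 : ℤ) = y at *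
  have key : ∀ c, c ≠ 0 → ∀ s, s = (if c = x then y else if c = y then x else if c = -x then -y else
      if c = -y then -x else c) →
      (shift s = shift c) ∨ (shift s = shift c + 1 ∧ (c = x ∨ c = -y)) ∨
      (shift s = shift c - 1 ∧ (c = -x ∨ c = y)) := by
    intro c hc s hs
    simp only [shift]
    rcases hp with ⟨rfl, rfl⟩ | ⟨h1, rfl⟩ <;> grind
  have h1 := key a ha _ rfl
  have h2 := key b hb _ rfl
  generalize (if a = x then y else if a = y then x else if a = -x then -y else
      if a = -y then -x else a) = sa at *
  generalize (if b = x then y else if b = y then x else if b = -x then -y else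
      if b = -y then -x else b) = sb at *
  clear key
  have hxy : shift y - shift x = 1 ∧ shift (-x) - shift (-y) = 1 := by
    rcases hp with ⟨rfl, rfl⟩ | ⟨h1, rfl⟩
    · decide
    · simp only [shift]; split_ifs <;> omega
  grind

/-- A simple reflection that lowers the height of a positive root that is not simple. -/
theorem exists_lower_aux {a b : ℤ} (ha : a ∈ punctured n) (hb : b ∈ punctured n) (hab : a < b)
    (hab' : -b < a) :
    (∃ p : SimpleIdx n, (p.1.1 : ℤ) = a ∧ (p.1.2 : ℤ) = b) ∨
    ∃ p : SimpleIdx n, val (simple p).1 a < val (simple p).1 b ∧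
      shift (val (simple p).1 b) - shift (val (simple p).1 a) = shift b - shift a - 1 ∧
      rootVec n a b = rootVec n (val (simple p).1 a) (val (simple p).1 b) + simpleRoot p := by
  have ha' := mem_punctured.1 ha
  have hb' := mem_punctured.1 hb
  by_cases h1 : (a = -1 ∧ b = 2) ∨ (1 ≤ a ∧ b = a + 1)
  · exact Or.inl (exists_simpleIdx ha hb h1)
  right
  -- The reflection exchanging b - 1 and b lowers the larger index b, except that it fixes e_b +
  -- e_(b-1); there the smaller index is lowered instead.
  by_cases h2 : a = -(b - 1)
  · obtain ⟨p, hp1, hp2⟩ := exists_simpleIdx (n := n) (a := b - 2) (b := b - 1)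
      (mem_punctured.2 (by omega)) (mem_punctured.2 (by omega)) (by omega)
    have ea : val (simple p).1 a = -(b - 2) := by
      rw [isSignedSwap_simple p a ha, hp1, hp2]; split_ifs <;> omega
    have eb : val (simple p).1 b = b := by
      rw [isSignedSwap_simple p b hb, hp1, hp2]; split_ifs <;> omega
    refine ⟨p, by rw [ea, eb]; omega, ?_, ?_⟩
    · rw [ea, eb]; simp only [shift]; split_ifs <;> omega
    · rw [ea, eb, simpleRoot_eq, hp1, hp2, h2]
      simp only [rootVec, basisVec_neg]; abel
  · obtain ⟨p, hp1, hp2⟩ := exists_simpleIdx (n := n) (a := b - 1) (b := b)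
      (mem_punctured.2 (by omega)) hb (by omega)
    have ea : val (simple p).1 a = a := by
      rw [isSignedSwap_simple p a ha, hp1, hp2]; split_ifs <;> omega
    have eb : val (simple p).1 b = b - 1 := by
      rw [isSignedSwap_simple p b hb, hp1, hp2]; split_ifs <;> omega
    refine ⟨p, by rw [ea, eb]; omega, ?_, ?_⟩
    · rw [ea, eb]; simp only [shift]; split_ifs <;> omega
    · rw [ea, eb, simpleRoot_eq, hp1, hp2]
      simp only [rootVec]; abel

theorem exists_lower {a b : ℤ} (ha : a ∈ punctured n) (hb : b ∈ punctured n) (hab : a < b)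
    (hab' : a ≠ -b) :
    (∃ p : SimpleIdx n, ((p.1.1 : ℤ) = a ∧ (p.1.2 : ℤ) = b) ∨
      ((p.1.1 : ℤ) = -b ∧ (p.1.2 : ℤ) = -a)) ∨
    ∃ p : SimpleIdx n, val (simple p).1 a < val (simple p).1 b ∧
      shift (val (simple p).1 b) - shift (val (simple p).1 a) = shift b - shift a - 1 ∧
      rootVec n a b = rootVec n (val (simple p).1 a) (val (simple p).1 b) + simpleRoot p := by
  have hs : ∀ x, shift (-x) = -shift x := by
    intro x; simp only [shift]; split_ifs <;> omega
  -- The pairs (a, b) and (-b, -a) give the same root, so -b < a may be assumed.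
  rcases lt_or_gt_of_ne hab' with h | h
  · rcases exists_lower_aux (neg_mem_punctured hb) (neg_mem_punctured ha) (by omega) (by omega)
      with ⟨p, hp⟩ | ⟨p, h1, h2, h3⟩
    · exact Or.inl ⟨p, Or.inr hp⟩
    · have ho := (isSigned_val (simple p).2.1).odd
      rw [ho, ho] at h1 h2 h3
      rw [rootVec_neg_neg, rootVec_neg_neg] at h3
      rw [hs, hs, hs, hs] at h2
      exact Or.inr ⟨p, by omega, by omega, h3⟩
  · rcases exists_lower_aux ha hb hab h with ⟨p, hp⟩ | h
    · exact Or.inl ⟨p, Or.inl hp⟩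
    · exact Or.inr h

theorem sum_single_smul (p : SimpleIdx n) :
    ∑ q : SimpleIdx n, (if q = p then (1 : ℝ) else 0) • simpleRoot q = simpleRoot p := by
  simp

/-- One induction on the height descends to a simple root. Reading the descent backwards shows that
e_b - e_a lies in the orbit and is a nonnegative combination; adding the reflection in the final
simple root gives a word of length h that makes it negative. -/
theorem rootVec_pos_aux (h : ℕ) : ∀ a ∈ punctured n, ∀ b ∈ punctured n, a < b → a ≠ -b →
    shift b - shift a = h →
    (∃ (u : groupD n) (p : SimpleIdx n), (val u.1 p.1.1 = a ∧ val u.1 p.1.2 = b) ∨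
      (val u.1 p.1.1 = -b ∧ val u.1 p.1.2 = -a)) ∧
    (∃ c : SimpleIdx n → ℝ, (∀ p, 0 ≤ c p) ∧
      rootVec n a b = ∑ p : SimpleIdx n, c p • simpleRoot p) ∧
    ∃ l : List (SimpleIdx n), l.length = h ∧
      act (l.map simple).prod (rootVec n a b) ∈ negRoots n := by
  induction h with
  | zero =>
    intro a ha b hb hab hab' h
    have := (mem_punctured.1 ha).1
    have := (mem_punctured.1 hb).1
    simp only [shift] at h
    split_ifs at h <;> omega
  | succ h ih =>
    intro a ha b hb hab hab' hh
    rcases exists_lower ha hb hab hab' with ⟨p, hp⟩ | ⟨p, h1, h2, h3⟩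
    · have hr : rootVec n a b = simpleRoot p := by
        rcases hp with ⟨hp1, hp2⟩ | ⟨hp1, hp2⟩
        · rw [simpleRoot_eq, hp1, hp2]
        · rw [simpleRoot_eq, hp1, hp2, rootVec_neg_neg]
      have hht := height_simpleRoot p
      rw [← hr, height_rootVec ha hb, hh] at hht
      have h0 : h = 0 := by
        have : ((h : ℕ) : ℝ) + 1 = 1 := by exact_mod_cast hht
        exact_mod_cast (by linarith : (h : ℝ) = 0)
      have hc : ∃ c : SimpleIdx n → ℝ, (∀ p, 0 ≤ c p) ∧
          rootVec n a b = ∑ p : SimpleIdx n, c p • simpleRoot p :=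
        ⟨fun q => if q = p then 1 else 0, fun q => by positivity, by rw [sum_single_smul, hr]⟩
      have hu : (val (1 : groupD n).1 p.1.1 = a ∧ val (1 : groupD n).1 p.1.2 = b) ∨
          (val (1 : groupD n).1 p.1.1 = -b ∧ val (1 : groupD n).1 p.1.2 = -a) := by
        simpa [val_one] using hp
      refine ⟨⟨1, p, hu⟩, hc, [p], by simp [h0], ?_⟩
      have e : act (([p] : List (SimpleIdx n)).map simple).prod (rootVec n a b) =
          -simpleRoot p := by
        rw [hr, List.map_singleton, List.prod_singleton, simpleRoot_eq,
          act_rootVec _ p.1.1.2 p.1.2.2, neg_rootVec,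
          isSignedSwap_simple p _ p.1.1.2, isSignedSwap_simple p _ p.1.2.2]
        rw [if_pos rfl, if_pos rfl, if_neg]
        rcases simpleIdx_cases p with hp | hp <;> omega
      rw [e, negRoots, Set.mem_ofPred_eq, neg_neg]
      refine ⟨⟨1, p, ?_⟩, by rw [← hr]; exact hc⟩
      rw [simpleRoot_eq, act_rootVec _ p.1.1.2 p.1.2.2]
      simp [val_one]
    · have ha1 := val_mem (simple p).1 ha
      have hb1 := val_mem (simple p).1 hb
      obtain ⟨⟨u, q, hu⟩, ⟨c, hc0, hc⟩, l, hl, hneg⟩ := ih _ ha1 _ hb1 h1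
        (by
          rw [← (isSigned_val (simple p).2.1).odd]
          exact fun h => hab' (val_injective _ h)) (by push_cast at hh; omega)
      have hss : simple p * simple p = 1 :=
        (isSignedSwap_simple p).mul_self p.1.1.2 p.1.2.2
          (by rcases simpleIdx_cases p with hp | hp <;> omega)
      have hinv : ∀ x, val (simple p).1 (val (simple p).1 x) = x := by
        intro x
        rw [← val_mul]
        have := congrArg (fun t : groupD n => val t.1 x) hss
        simpa [val_one] using this
      have ho := (isSigned_val (simple p).2.1).odd
      refine ⟨⟨simple p * u, q, ?_⟩, ⟨fun r => c r + if r = p then 1 else 0, fun r => ?_, ?_⟩,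
        l ++ [p], by simp [hl], ?_⟩
      · have hm : ∀ x, val (simple p * u).1 x = val (simple p).1 (val u.1 x) := fun x => val_mul _ _ x
        rw [hm, hm]
        rcases hu with ⟨hu1, hu2⟩ | ⟨hu1, hu2⟩
        · left
          rw [hu1, hu2, hinv, hinv]
          exact ⟨rfl, rfl⟩
        · right
          rw [hu1, hu2, ho, ho, hinv, hinv]
          exact ⟨rfl, rfl⟩
      · have := hc0 r
        positivity
      · simp only [add_smul, Finset.sum_add_distrib]
        rw [sum_single_smul, ← hc, h3]
      · rw [List.map_append, List.prod_append, act_rootVec _ ha hb]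
        rw [act_rootVec _ ha1 hb1] at hneg
        have hm : ∀ x, val ((l.map simple).prod * (([p] : List (SimpleIdx n)).map simple).prod).1 x =
            val (l.map simple).prod.1 (val (simple p).1 x) := fun x => by
          rw [← val_mul]; simp
        rw [hm, hm]
        exact hneg

section

variable {a b : ℤ}

theorem shift_lt_shift (ha : a ≠ 0) (hab : a < b) (hab' : a ≠ -b) (hb : b ≠ 0) :
    shift a < shift b := by
  simp only [shift]; split_ifs <;> omega

theorem exists_conj (ha : a ∈ punctured n) (hb : b ∈ punctured n) (hab : a < b) (hab' : a ≠ -b) :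
    ∃ t : groupD n, IsSignedSwap t.1 a b ∧ IsReflectionOf t (rootVec n a b) := by
  have hlt := shift_lt_shift (mem_punctured.1 ha).1 hab hab' (mem_punctured.1 hb).1
  obtain ⟨⟨u, p, hu⟩, -⟩ := rootVec_pos_aux (shift b - shift a).toNat a ha b hb hab hab' (by omega)
  refine ⟨u * simple p * u⁻¹, ?_, u, p, ?_, rfl⟩
  · have := (isSignedSwap_simple p).conj (u := u)
    rcases hu with ⟨h1, h2⟩ | ⟨h1, h2⟩
    · rwa [h1, h2] at this
    · rw [h1, h2] at this
      simpa using this.neg_neg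
  · rw [simpleRoot_eq, act_rootVec _ p.1.1.2 p.1.2.2]
    rcases hu with ⟨h1, h2⟩ | ⟨h1, h2⟩
    · rw [h1, h2]
    · rw [h1, h2, rootVec_neg_neg]

theorem rootVec_mem_posRoots (ha : a ∈ punctured n) (hb : b ∈ punctured n) (hab : a < b)
    (hab' : a ≠ -b) : rootVec n a b ∈ posRoots n := by
  have hlt := shift_lt_shift (mem_punctured.1 ha).1 hab hab' (mem_punctured.1 hb).1
  obtain ⟨-, hc, -⟩ := rootVec_pos_aux (shift b - shift a).toNat a ha b hb hab hab' (by omega)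
  obtain ⟨t, -, u, p, h, -⟩ := exists_conj ha hb hab hab'
  exact ⟨⟨u, p, h⟩, hc⟩

theorem shift_sub_prod (l : List (SimpleIdx n)) (ha : a ∈ punctured n) (hb : b ∈ punctured n)
    (hab' : a ≠ -b) (hl : (l.length : ℤ) < shift b - shift a) :
    shift b - shift a - l.length ≤
      shift (val (l.map simple).prod.1 b) - shift (val (l.map simple).prod.1 a) := by
  induction l with
  | nil => simp [val_one]
  | cons p l ih =>
    rw [List.length_cons] at hl ⊢
    have ih := ih (by omega)
    have hm : ∀ x, val (((p :: l).map simple).prod).1 x =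
        val (simple p).1 (val (l.map simple).prod.1 x) := fun x => by
      rw [← val_mul]; simp
    rw [hm, hm]
    have := shift_sub_le_simple (p := p) (val_mem (l.map simple).prod.1 ha)
      (val_mem (l.map simple).prod.1 hb)
      (by
        rw [← (isSigned_val (l.map simple).prod.2.1).odd]
        exact fun h => hab' (val_injective _ h)) (by omega)
    omega

/-- A word shorter than the height leaves the height positive, whereas negative roots have height at
most 0; the descent to a simple root supplies a word of the right length. -/
theorem rootDepth_rootVec (ha : a ∈ punctured n) (hb : b ∈ punctured n) (hab : a < b)
    (hab' : a ≠ -b) : (rootDepth (rootVec n a b) : ℤ) = shift b - shift a := by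
  have hlt := shift_lt_shift (mem_punctured.1 ha).1 hab hab' (mem_punctured.1 hb).1
  obtain ⟨-, -, l, hl, hneg⟩ :=
    rootVec_pos_aux (shift b - shift a).toNat a ha b hb hab hab' (by omega)
  have hle : rootDepth (rootVec n a b) ≤ (shift b - shift a).toNat :=
    Nat.sInf_le ⟨l, hl, hneg⟩
  obtain ⟨l', hl', hneg'⟩ : rootDepth (rootVec n a b) ∈ {r | ∃ l : List (SimpleIdx n),
      l.length = r ∧ act (l.map simple).prod (rootVec n a b) ∈ negRoots n} :=
    Nat.sInf_mem ⟨_, l, hl, hneg⟩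
  by_contra hne
  have hlen : (l'.length : ℤ) < shift b - shift a := by omega
  have h1 := shift_sub_prod l' ha hb hab' hlen
  have h2 := height_nonneg hneg'
  rw [act_rootVec _ ha hb, map_neg, height_rootVec (val_mem _ ha) (val_mem _ hb)] at h2
  have h3 : shift (val (l'.map simple).prod.1 b) - shift (val (l'.map simple).prod.1 a) ≤ 0 := by
    exact_mod_cast (by linarith :
      ((shift (val (l'.map simple).prod.1 b) - shift (val (l'.map simple).prod.1 a) : ℤ) : ℝ) ≤ 0)
  omega

end

theorem IsSignedSwap.swapAt {t w : groupD n} {i j ε : ℤ} (h : IsSignedSwap t.1 (ε * i) j)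
    (hi : 1 ≤ i) (hij : i < j) (hj : j ≤ n) (hε : ε = 1 ∨ ε = -1) :
    SwapAt n (val w.1) (val (w * t).1) i j ε := by
  have hm : ∀ x, val (w * t).1 x = val w.1 (val t.1 x) := fun x => val_mul _ _ x
  have hv : ∀ x : ℤ, 1 ≤ x → x ≤ n → x ∈ punctured n := fun x h1 h2 => mem_punctured.2 (by omega)
  have ho := (isSigned_val w.2.1).odd
  refine ⟨hi, hij, hj, hε, ?_, ?_, fun k h1 h2 h3 h4 => ?_⟩
  · rw [hm, h i (hv i (by omega) (by omega))]
    rcases hε with rfl | rfl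
    · rw [if_pos (by omega), one_mul]
    · rw [if_neg (by omega), if_neg (by omega), if_pos (by omega), ho]; ring
  · rw [hm, h j (hv j (by omega) (by omega))]
    rcases hε with rfl | rfl
    · rw [if_neg (by omega), if_pos rfl, one_mul, one_mul]
    · rw [if_neg (by omega), if_pos rfl, neg_one_mul, ho]; ring
  · rw [hm, h k (hv k h1 h2)]
    rcases hε with rfl | rfl <;>
      rw [if_neg (by omega), if_neg (by omega), if_neg (by omega), if_neg (by omega)]

theorem exists_reflection {i j ε : ℤ} (hi : 1 ≤ i) (hij : i < j) (hj : j ≤ n)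
    (hε : ε = 1 ∨ ε = -1) : ∃ (t : groupD n) (β : Fin n → ℝ), β ∈ posRoots n ∧
      IsReflectionOf t β ∧ (rootDepth β : ℤ) = shift j - ε * shift i ∧ t * t = 1 ∧
      ∀ w : groupD n, SwapAt n (val w.1) (val (w * t).1) i j ε := by
  have ha : ε * i ∈ punctured n := mem_punctured.2 (by rcases hε with rfl | rfl <;> omega)
  have hb : j ∈ punctured n := mem_punctured.2 (by omega)
  have hab : ε * i < j := by rcases hε with rfl | rfl <;> omega
  have hab' : ε * i ≠ -j := by rcases hε with rfl | rfl <;> omega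
  obtain ⟨t, ht, hr⟩ := exists_conj ha hb hab hab'
  refine ⟨t, _, rootVec_mem_posRoots ha hb hab hab', hr, ?_, ht.mul_self ha hb hab.ne,
    fun w => ht.swapAt hi hij hj hε⟩
  rw [rootDepth_rootVec ha hb hab hab']
  congr 1
  rcases hε with rfl | rfl <;> simp only [shift] <;> split_ifs <;> omega

theorem IsReflectionOf.exists_swapAt {t : groupD n} {β : Fin n → ℝ} (h : IsReflectionOf t β)
    (hβ : β ∈ posRoots n) : ∃ i j ε, (rootDepth β : ℤ) = shift j - ε * shift i ∧
      ∀ w : groupD n, SwapAt n (val w.1) (val (w * t).1) i j ε := by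
  obtain ⟨u, p, hu, rfl⟩ := h
  have hs := (isSignedSwap_simple p).conj (u := u)
  rw [simpleRoot_eq, act_rootVec _ p.1.1.2 p.1.2.2] at hu
  have ha := val_mem u.1 p.1.1.2
  have hb := val_mem u.1 p.1.2.2
  have hab : val u.1 p.1.1 ≠ val u.1 p.1.2 := fun h => by
    have := val_injective _ h
    rcases simpleIdx_cases p with hp | hp <;> omega
  have hab' : val u.1 p.1.1 ≠ -val u.1 p.1.2 := fun h => by
    rw [← (isSigned_val u.2.1).odd] at h
    have := val_injective _ h
    rcases simpleIdx_cases p with hp | hp <;> omega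
  generalize val u.1 p.1.1 = a at *
  generalize val u.1 p.1.2 = b at *
  have ha' := mem_punctured.1 ha
  have hb' := mem_punctured.1 hb
  -- The height of a positive root is nonnegative, while a > b would make it negative.
  have hlt : a < b := by
    by_contra! hle
    have h1 := shift_lt_shift hb'.1 (lt_of_le_of_ne hle hab.symm) (by omega) ha'.1
    have h2 := height_nonneg hβ
    rw [hu, height_rootVec ha hb] at h2
    have h3 : (0 : ℤ) ≤ shift b - shift a := by exact_mod_cast h2
    omega
  -- Once -b < a < b, the positions are |a| < b and ε is the sign of a.
  have key : ∀ a b : ℤ, a ∈ punctured n → b ∈ punctured n → a < b → -b < a →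
      β = rootVec n a b → IsSignedSwap (u * simple p * u⁻¹).1 a b →
      ∃ i j ε, (rootDepth β : ℤ) = shift j - ε * shift i ∧
      ∀ w : groupD n, SwapAt n (val w.1) (val (w * (u * simple p * u⁻¹)).1) i j ε := by
    intro a b ha hb h1 h2 hβ hs
    have ha' := mem_punctured.1 ha
    have hb' := mem_punctured.1 hb
    rw [hβ, rootDepth_rootVec ha hb h1 (by omega)]
    rcases lt_or_gt_of_ne ha'.1 with h | h
    · refine ⟨-a, b, -1, ?_, fun w => ?_⟩
      · congr 1
        simp only [shift]; split_ifs <;> omega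
      · exact IsSignedSwap.swapAt (by rwa [neg_one_mul, neg_neg]) (by omega) (by omega) hb'.2.2
          (Or.inr rfl)
    · refine ⟨a, b, 1, by rw [one_mul], fun w => ?_⟩
      exact IsSignedSwap.swapAt (by rwa [one_mul]) (by omega) (by omega) hb'.2.2 (Or.inl rfl)
  rcases lt_or_gt_of_ne hab' with h | h
  · exact key (-b) (-a) (neg_mem_punctured hb) (neg_mem_punctured ha) (by omega) (by omega)
      (by rw [hu, rootVec_neg_neg]) hs.neg_neg
  · exact key a b ha hb hlt h hu hs

end SignedPerm

/-! ### Depth is half the cost, and the two closed forms -/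

namespace SignedPerm

variable {n : ℕ}

theorem cost_nonneg (n : ℤ) (g : ℤ → ℤ) : 0 ≤ cost n g :=
  add_nonneg (Finset.sum_nonneg fun _ _ => abs_nonneg _) (by positivity)

theorem negs_one_val (p : ℤ) : negs (val (1 : groupD n).1) p = 0 := by
  rw [negs, Finset.card_eq_zero, Finset.filter_eq_empty_iff]
  intro i hi
  have := Finset.mem_Icc.1 hi
  have e : val (1 : groupD n).1 i = i := val_one i
  rw [e]
  omega

theorem cost_one : cost n (val (1 : groupD n).1) = 0 := by
  have e : ∀ i, val (1 : groupD n).1 i = i := fun i => val_one i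
  have h1 : oddCuts n (val (1 : groupD n).1) = ∅ := by
    rw [Finset.eq_empty_iff_forall_notMem]
    intro p hp
    have := (mem_oddCuts.1 hp).2.2.2
    rw [negs_one_val] at this
    simp at this
  rw [cost, h1, disp, Finset.sum_eq_zero fun i _ => by rw [e, sub_self, abs_zero]]
  simp

/-- A factorization of `w` into reflections, each paired with its positive root. -/
def IsFactorization (w : groupD n) (l : List (groupD n × (Fin n → ℝ))) : Prop :=
  (∀ x ∈ l, x.2 ∈ posRoots n ∧ IsReflectionOf x.1 x.2) ∧ w = (l.map Prod.fst).prod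

/-- The identity has cost 0, and each factor appended on the right is a swap, raising the cost by at
most twice its depth. -/
theorem cost_le_of_isFactorization {l : List (groupD n × (Fin n → ℝ))} {w : groupD n}
    (h : IsFactorization w l) :
    cost n (val w.1) ≤ 2 * ((l.map fun x => rootDepth x.2).sum : ℕ) := by
  obtain ⟨h, rfl⟩ := h
  induction l using List.reverseRecOn with
  | nil => simpa using cost_one.le
  | append_singleton l x ih =>
    have ih := ih fun y hy => h y (List.mem_append_left _ hy)
    obtain ⟨h1, h2⟩ := h x (List.mem_append_right _ (List.mem_singleton.2 rfl))
    obtain ⟨i, j, ε, hd, hs⟩ := h2.exists_swapAt h1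
    have := (hs (l.map Prod.fst).prod).cost_lipschitz
      (isSigned_val (l.map Prod.fst).prod.2.1) (isSigned_val ((l.map Prod.fst).prod * x.1).2.1)
    simp only [List.map_append, List.map_cons, List.map_nil, List.prod_append, List.prod_singleton,
      List.sum_append, List.sum_singleton]
    omega

theorem exists_isFactorization (N : ℕ) : ∀ w : groupD n, (cost n (val w.1)).toNat = N →
    ∃ l, IsFactorization w l ∧
      2 * ((l.map fun x => rootDepth x.2).sum : ℕ) ≤ cost n (val w.1) := by
  induction N using Nat.strong_induction_on with
  | _ N ih =>
    intro w hN
    by_cases hne : ∃ k : ℤ, 1 ≤ k ∧ k ≤ n ∧ val w.1 k ≠ k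
    · obtain ⟨i, j, ε, h1, h2, h3, h4, h5⟩ := exists_descent (isSigned_val w.2.1) w.2.2 hne
      obtain ⟨t, β, hβ, ht, hd, htt, hs⟩ := exists_reflection h1 h2 h3 h4
      have h6 := h5 _ (isSigned_val (w * t).2.1) (hs w)
      have h7 : 0 < shift j - ε * shift i := by
        rw [shift_of_pos (by omega), shift_of_pos (by omega)]
        rcases h4 with rfl | rfl <;> omega
      have h8 := cost_nonneg n (val (w * t).1)
      -- Every swap has positive price, so the cost strictly decreases and the induction applies to
      -- `w * t`.
      obtain ⟨l, ⟨hl1, hl2⟩, hl3⟩ := ih _ (by omega) (w * t) rfl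
      refine ⟨l ++ [(t, β)], ⟨fun x hx => ?_, ?_⟩, ?_⟩
      · rcases List.mem_append.1 hx with hx | hx
        · exact hl1 x hx
        · rw [List.mem_singleton.1 hx]
          exact ⟨hβ, ht⟩
      · simp only [List.map_append, List.map_cons, List.map_nil, List.prod_append,
          List.prod_singleton]
        rw [← hl2, mul_assoc, htt, mul_one]
      · simp only [List.map_append, List.map_cons, List.map_nil, List.sum_append,
          List.sum_singleton]
        omega
    · push Not at hne
      have hw : w = 1 := by
        apply Subtype.ext
        ext i
        have hi := mem_punctured.1 i.2
        have e : ((w.1 i : punctured n) : ℤ) = val w.1 i := (val_coe _ i).symm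
        rw [e]
        change val w.1 i = (i : ℤ)
        rcases lt_or_gt_of_ne hi.1 with h | h
        · have h1 := hne (-i) (by omega) (by omega)
          rw [(isSigned_val w.2.1).odd] at h1
          omega
        · exact hne i (by omega) (by omega)
      subst hw
      exact ⟨[], ⟨by simp, by simp⟩, by simpa using cost_nonneg _ _⟩

theorem two_mul_depth (w : groupD n) : 2 * (depth w : ℤ) = cost n (val w.1) := by
  obtain ⟨l, ⟨hl1, hl2⟩, hl3⟩ := exists_isFactorization _ w rfl
  have hmem : (l.map fun x => rootDepth x.2).sum ∈ {d | ∃ l : List (groupD n × (Fin n → ℝ)),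
      (∀ x ∈ l, x.2 ∈ posRoots n ∧ IsReflectionOf x.1 x.2) ∧
      w = (l.map Prod.fst).prod ∧ d = (l.map fun x => rootDepth x.2).sum} :=
    ⟨l, hl1, hl2, rfl⟩
  have hle : depth w ≤ (l.map fun x => rootDepth x.2).sum := Nat.sInf_le hmem
  obtain ⟨l', h1, h2, h3⟩ := Nat.sInf_mem ⟨_, hmem⟩
  have h3 : depth w = (l'.map fun x => rootDepth x.2).sum := h3
  have := cost_le_of_isFactorization ⟨h1, h2⟩
  omega

theorem sum_abs_eq {g : ℤ → ℤ} {m : ℤ} (hg : IsSigned m g) :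
    ∑ i ∈ Finset.Icc 1 m, |g i| = ∑ i ∈ Finset.Icc 1 m, i := by
  have hmaps : ∀ i ∈ Finset.Icc 1 m, |g i| ∈ Finset.Icc 1 m := fun i hi => by
    have hi := Finset.mem_Icc.1 hi
    exact Finset.mem_Icc.2 ⟨hg.one_le_abs hi.1, hg.le i hi.1 hi.2⟩
  have hinj : Set.InjOn (fun i => |g i|) (Finset.Icc 1 m : Set ℤ) := fun i hi j hj h =>
    hg.abs_inj (Finset.mem_Icc.1 (Finset.mem_coe.1 hi)).1
      (Finset.mem_Icc.1 (Finset.mem_coe.1 hj)).1 h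
  exact Finset.sum_nbij (fun i => |g i|) hmaps hinj
    (Finset.surjOn_of_injOn_of_card_le (fun i => |g i|) hmaps hinj le_rfl) fun _ _ => rfl

theorem disp_eq_sum {g : ℤ → ℤ} {m : ℤ} (hg : IsSigned m g) :
    disp m g = 2 * (∑ i ∈ (Finset.Icc 1 m).filter (fun i => i < g i), (g i - i)) +
      2 * (∑ i ∈ (Finset.Icc 1 m).filter (fun i => g i < 0), |g i|) - 2 * negs g m := by
  have hneg : (negs g m : ℤ) = ∑ i ∈ Finset.Icc 1 m, if g i < 0 then 1 else 0 := by
    simp [negs]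
  rw [hneg, Finset.sum_filter, Finset.sum_filter, Finset.mul_sum, Finset.mul_sum, Finset.mul_sum,
    ← Finset.sum_add_distrib, ← Finset.sum_sub_distrib]
  have h0 : ∑ i ∈ Finset.Icc 1 m, (|g i| - i) = 0 := by
    rw [Finset.sum_sub_distrib, sum_abs_eq hg, sub_self]
  -- The identity fails term by term; adding |g i| - i, whose sum vanishes because |g| permutes [1,
  -- m], turns |g i - i| into twice its positive part when g i > 0.
  have h2 : disp m g = disp m g + ∑ i ∈ Finset.Icc 1 m, (|g i| - i) := by rw [h0, add_zero]
  rw [h2, disp, ← Finset.sum_add_distrib]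
  refine Finset.sum_congr rfl fun i hi => ?_
  have hi := Finset.mem_Icc.1 hi
  have h1 := hg.ne_zero (by omega : i ≠ 0)
  rw [shift_of_pos (by omega : 0 < i)]
  simp only [shift, abs]
  split_ifs <;> omega

theorem disp_eq_abs {g : ℤ → ℤ} {m : ℤ} (hg : IsSigned m g) :
    disp m g = ∑ i ∈ Finset.Icc 1 m, |g i - i| - 2 * negs g m := by
  have hneg : (negs g m : ℤ) = ∑ i ∈ Finset.Icc 1 m, if g i < 0 then 1 else 0 := by
    simp [negs]
  rw [hneg, Finset.mul_sum, ← Finset.sum_sub_distrib]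
  refine Finset.sum_congr rfl fun i hi => ?_
  have hi := Finset.mem_Icc.1 hi
  have h0 := hg.ne_zero (by omega : i ≠ 0)
  rw [shift_of_pos (by omega : 0 < i)]
  simp only [shift, abs]
  split_ifs <;> omega

/-- By oddness, -i contributes i - g i exactly when g i < i, so i and -i together contribute |g i -
i|. -/
theorem sum_excedance_eq {g : ℤ → ℤ} (hg : IsSigned n g) :
    ∑ i ∈ (punctured n).filter (fun i => i < g i), (g i - i) = ∑ i ∈ Finset.Icc 1 (n : ℤ), |g i - i| := by
  have h1 : punctured n = Finset.Icc 1 (n : ℤ) ∪ (Finset.Icc 1 (n : ℤ)).image (fun i => -i) := by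
    ext i
    simp only [mem_punctured, Finset.mem_union, Finset.mem_Icc, Finset.mem_image]
    constructor
    · intro h
      by_cases hi : 0 < i
      · left; omega
      · right; exact ⟨-i, by omega, by omega⟩
    · rintro (h | ⟨j, h, rfl⟩) <;> omega
  have h2 : Disjoint (Finset.Icc 1 (n : ℤ)) ((Finset.Icc 1 (n : ℤ)).image (fun i => -i)) := by
    rw [Finset.disjoint_left]
    intro i hi hi'
    obtain ⟨j, hj, rfl⟩ := Finset.mem_image.1 hi'
    have := Finset.mem_Icc.1 hi
    have := Finset.mem_Icc.1 hj
    omega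
  rw [Finset.sum_filter, h1, Finset.sum_union h2, Finset.sum_image (fun i _ j _ h => neg_injective h),
    ← Finset.sum_add_distrib]
  refine Finset.sum_congr rfl fun i _ => ?_
  rw [hg.odd]
  simp only [abs]
  split_ifs <;> omega

end SignedPerm

theorem theorem2p7 (n : ℕ) (w : SignedPerm.groupD n) :
    ((SignedPerm.depth w : ℤ) =
      (∑ i ∈ (Finset.Icc (1 : ℤ) n).filter (fun i => i < SignedPerm.val w.1 i),
        (SignedPerm.val w.1 i - i)) +
      (∑ i ∈ (Finset.Icc (1 : ℤ) n).filter (fun i => SignedPerm.val w.1 i < 0),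
        |SignedPerm.val w.1 i|) +
      (SignedPerm.oddnessD w - SignedPerm.neg w.1)) ∧
    ((SignedPerm.depth w : ℚ) =
      1 / 2 * (((∑ i ∈ (SignedPerm.punctured n).filter (fun i => i < SignedPerm.val w.1 i),
        (SignedPerm.val w.1 i - i) : ℤ) : ℚ) - 2 * (SignedPerm.neg w.1 : ℚ)) +
      (SignedPerm.oddnessD w : ℚ)) := by
  have hw := SignedPerm.isSigned_val w.2.1
  have hd := SignedPerm.two_mul_depth w
  rw [SignedPerm.cost, ← SignedPerm.oddnessD_eq] at hd
  constructor
  · rw [SignedPerm.disp_eq_sum hw, ← SignedPerm.neg_eq_negs] at hd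
    omega
  · rw [SignedPerm.disp_eq_abs hw, ← SignedPerm.neg_eq_negs, ← SignedPerm.sum_excedance_eq hw] at hd
    have := congrArg (fun z : ℤ => (z : ℚ)) hd
    generalize ∑ i ∈ (SignedPerm.punctured n).filter (fun i => i < SignedPerm.val w.1 i),
        (SignedPerm.val w.1 i - i) = S at *
    push_cast at this
    linarith
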